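/- Identify the Euclidean plane with $\mathbb{C}$ and let $A_2=\mathbb{Z}\,(1,0)+\mathbb{Z}\,(\tfrac12,\tfrac{\sqrt3}{2})$ be the hexagonal lattice. A fundamental cell of a lattice $\Gamma$ is the closure $F$ of a set that contains exactly one point of each coset of $\Gamma$, such that the translates $F+g$ ($g\in\Gamma$) cover the plane and have pairwise disjoint interiors. Let $S(F)$ be the group of all Euclidean motions mapping $F$ onto itself, and let $D_{12}$ be the group of order 24 generated by the rotation through $\pi/6$ about $0$ and the reflection in the real axis. Packings. Let $Q_0$ consist of the regular dodecagons of inradius $\tfrac12$ centred at the points of $A_2$ (the dodecagons of the Archimedean tiling $3.12^2$), and let $Q_{n+1}$ consist of the regular dodecagons of inradius $\tfrac12(2-\sqrt3)^{n+1}$ centred at the vertices of the dodecagons of $Q_n$. All dodecagons have their vertices, seen from the centre, in the directions $(2k+1)\pi/12$. A dodecagon with centre $x$ is divided into the twelve pieces cut out by the cones with apex $x$ spanned by the directions $k\pi/6$ and $(k+1)\pi/6$, $0\le k\le 11$. Refinement. Let $F_0$ be the dodecagon of $Q_0$ centred at $0$. Given $F_n$, each dodecagon of $Q_{n+1}$ is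 coloured white, red, or mixed (its twelve pieces are alternately red and white, in one of the two possible ways), where a dodecagon centred outside $F_n$ is white and a dodecagon centred in the interior of $F_n$ is red. Then $$F_{n+1}=\overline{\Bigl(F_n\setminus\bigcup Q_{n+1}\Bigr)\cup R_{n+1}},$$ where $R_{n+1}$ is the union of the red dodecagons of $Q_{n+1}$ and of the red pieces of its mixed dodecagons. Let $F_\triangle$ be the closure of the set of all points that have a neighbourhood contained in all but finitely many of the $F_n$. Proposition. The colours can be chosen such that $F_\triangle$ is a compact fundamental cell of $A_2$ with $S(F_\triangle)=D_{12}$ and $\operatorname{diam}(F_\triangle)=\sqrt2$. In particular, $A_2$ has a compact fundamental cell with symmetry group $D_{12}$. -/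

import Mathlib

open scoped Pointwise

noncomputable section

/-! The Euclidean plane is modelled by `ℂ`. -/

namespace HexagonalCell

/-- The hexagonal lattice, spanned over the integers by `(1, 0)` and `(1/2, √3/2)`. -/
def hexagonalLattice : AddSubgroup ℂ :=
  AddSubgroup.closure {1, ⟨1 / 2, Real.sqrt 3 / 2⟩}

/-- The group of all Euclidean motions (reflections and translations included) that map `X`
onto itself. -/
def symmetryGroup (X : Set ℂ) : Subgroup (ℂ ≃ᵢ ℂ) where
  carrier := {φ | φ '' X = X}
  one_mem' := by simp
  mul_mem' := by
    intro φ ψ hφ hψ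
    simp only [Set.mem_ofPred_eq] at hφ hψ ⊢
    rw [IsometryEquiv.coe_mul, Set.image_comp, hψ, hφ]
  inv_mem' := by
    intro φ hφ
    simp only [Set.mem_ofPred_eq] at hφ ⊢
    calc (φ⁻¹ : ℂ ≃ᵢ ℂ) '' X = (φ⁻¹ : ℂ ≃ᵢ ℂ) '' (φ '' X) := by rw [hφ]
      _ = X := by rw [← Set.image_comp, ← IsometryEquiv.coe_mul, inv_mul_cancel]; simp

/-- The dihedral group `D_n` of order `2n` as a group of motions fixing the origin: it is
generated by the rotation through `2π/n` about `0` and the reflection in the real axis. -/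
def dihedralMotions (n : ℕ) : Subgroup (ℂ ≃ᵢ ℂ) :=
  Subgroup.closure
    {(rotation (Circle.exp (2 * Real.pi / n))).toIsometryEquiv,
      Complex.conjLIE.toIsometryEquiv}

/-- `F` is a fundamental cell of `Γ`: it is the closure of a set that contains exactly one point
of each coset of `Γ`, and its translates by the elements of `Γ` cover the plane and have pairwise
disjoint interiors. -/
structure IsFundamentalCell (Γ : AddSubgroup ℂ) (F : Set ℂ) : Prop where
  exists_transversal : ∃ D : Set ℂ, (∀ x : ℂ, ∃! g : ℂ, g ∈ Γ ∧ x ∈ g +ᵥ D) ∧ closure D = F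
  covers : ⋃ g ∈ Γ, (g +ᵥ F) = Set.univ
  nonoverlapping : ∀ g ∈ Γ, ∀ h ∈ Γ, g ≠ h →
    Disjoint (interior (g +ᵥ F)) (interior (h +ᵥ F))

/-! ### The dodecagon packings -/

/-- The vector from the centre of a dodecagon of generation `n` to its `k`-th vertex, in direction
`(2k+1)π/12`. The inradius is `(2 - √3) ^ n / 2`, so in generation `0` dodecagons centred at
neighbouring lattice points share an edge. The edge length is `(2 - √3) ^ (n + 1)`. -/
def vertexVector (n : ℕ) (k : Fin 12) : ℂ :=
  (((2 - Real.sqrt 3) ^ n / (2 * Real.cos (Real.pi / 12)) : ℝ) : ℂ) *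
    Complex.exp (((2 * (k : ℕ) + 1 : ℝ) * Real.pi / 12 : ℝ) * Complex.I)

/-- The regular dodecagon of generation `n` with centre `x`. -/
def dodecagon (n : ℕ) (x : ℂ) : Set ℂ :=
  convexHull ℝ (Set.range fun k : Fin 12 => x + vertexVector n k)

/-- The centres of the dodecagons of the packing of generation `n`: the lattice points for
`n = 0`, and the vertices of the dodecagons of the previous packing afterwards. -/
def centres : ℕ → Set ℂ
  | 0 => (hexagonalLattice : Set ℂ)
  | n + 1 => {v | ∃ x ∈ centres n, ∃ k : Fin 12, v = x + vertexVector n k}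

/-! ### Colouring and refinement -/

/-- The unit vector in direction `k * π / 6`. -/
def unitVector (k : ℕ) : ℂ := Complex.exp (((k : ℝ) * Real.pi / 6 : ℝ) * Complex.I)

/-- The cone with apex `x` spanned by `u` and `w`. -/
def cone (x u w : ℂ) : Set ℂ :=
  {z | ∃ s t : ℝ, 0 ≤ s ∧ 0 ≤ t ∧ z = x + (s : ℂ) * u + (t : ℂ) * w}

/-- The `k`-th of the twelve congruent pieces of a dodecagon. -/
def piece (n : ℕ) (x : ℂ) (k : Fin 12) : Set ℂ :=
  dodecagon n x ∩ cone x (unitVector k) (unitVector (k + 1 : ℕ))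

/-- The four ways to colour a dodecagon: white, red, or mixed. In a mixed dodecagon the twelve
pieces are alternately red and white. -/
inductive Colour
  | white
  | red
  | evenRed
  | oddRed

/-- The red part of a coloured dodecagon. -/
def redPart (n : ℕ) (x : ℂ) : Colour → Set ℂ
  | .white => ∅
  | .red => dodecagon n x
  | .evenRed => ⋃ k ∈ {k : Fin 12 | Even (k : ℕ)}, piece n x k
  | .oddRed => ⋃ k ∈ {k : Fin 12 | Odd (k : ℕ)}, piece n x k

/-- The `n`-th iterate, where `c n v` is the colour of the dodecagon of generation `n ≥ 1` with
centre `v`: start with the dodecagon of generation `0` at the origin; in each step, replace the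
part covered by the next packing by the red part of that packing. -/
def iterate (c : ℕ → ℂ → Colour) : ℕ → Set ℂ
  | 0 => dodecagon 0 0
  | n + 1 => closure ((iterate c n \ ⋃ v ∈ centres (n + 1), dodecagon (n + 1) v) ∪
      ⋃ v ∈ centres (n + 1), redPart (n + 1) v (c (n + 1) v))

/-- Dodecagons of the next packing centred outside the current iterate are white, those centred in
its interior are red. Only those centred on its boundary may be mixed. -/
def IsRefinement (c : ℕ → ℂ → Colour) : Prop :=
  ∀ n : ℕ, ∀ v ∈ centres (n + 1),
    (v ∉ iterate c n → c (n + 1) v = .white) ∧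
    (v ∈ interior (iterate c n) → c (n + 1) v = .red)

/-- The closure of the limit of the iterates. As the iterates are closed regions that matter only
up to their boundaries, a point is counted in the limit if it has a neighbourhood that is contained
in all but finitely many iterates. -/
def limitCell (c : ℕ → ℂ → Colour) : Set ℂ :=
  closure (⋃ n : ℕ, interior (⋂ m ≥ n, iterate c m))

end HexagonalCell

end

noncomputable section

namespace HexagonalCell

/-! ### The ratio of the packings and the ring of integer coordinates -/

/-! The colouring is chosen locally. Let `w` be vertex `k` of a dodecagon of generation `n` with
centre `x`. In the dodecagon of generation `n + 1` at `w`, the pieces with the parity of `k` take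
the colour that `cells n` shows just beside `w` in the direction of `x`; the other pieces take the
colour in the opposite direction (`Germ`, `linkDir`). The first direction runs into piece `k` at
`x`. If `w` is also a vertex of a second dodecagon, its index there is `k + 5` or `k + 7`, of the
other parity, and either dodecagon prescribes the same colours (`red_succ_iff`). The rule therefore
depends on no choice.

Translates. A piece that is red in both a cell and its translate yields a germ common to the
previous cell and its translate, so an overlap would descend to generation 0
(`not_mem_interior_cells_sub`). Conversely every piece is red in some translate (`exists_red`). If
its germ does not enter a dodecagon of generation `n` at one of its vertices, then `w` lies deep
inside an earlier dodecagon (`exists_link_or_subset`); the germ enters an open piece of the last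
packing that it meets, and induction applies there.

Symmetry. The rule only compares parities, so an isometry about 0 that permutes vertices and pieces
and reverses all parities respects it. The rotation through `π / 6` does not preserve the lattice,
but only dodecagons descending from the one at 0 influence the cells (`cells_subset`), and these are
permuted (`cells_invariant`).

Limit. The packings have dense union (`exists_mem_packing`), and a disc about the centre of a
dodecagon is never repainted within it (`not_mem_packing_of_near_centre`). Hence the lattice
translates of `stable` are dense (`exists_sub_mem_stable`), while `stable` meets each coset at most
once. A choice of coset representatives, taken from `stable` where possible, is the required
transversal.

Size. Summing inradii along chains of vertices confines the limit to a regular dodecagon of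
circumradius `√2 / 2`, all of whose vertices are attained (`extreme_mem`). A motion preserving the
limit sends opposite vertices to points at distance `√2`, hence again to opposite vertices; it fixes
0 and is one of the 24 elements of the dihedral group. -/

/-- The ratio `2 - √3` of successive generations. -/
def ratio : ℝ := 2 - Real.sqrt 3

theorem sqrt_three_sq : Real.sqrt 3 * Real.sqrt 3 = 3 := Real.mul_self_sqrt (by norm_num)

theorem sqrt_three_gt : (1.732 : ℝ) < Real.sqrt 3 := Real.lt_sqrt_of_sq_lt (by norm_num)

theorem sqrt_three_lt : Real.sqrt 3 < (1.7321 : ℝ) := by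
  rw [Real.sqrt_lt' (by norm_num)]; norm_num

theorem ratio_gt : (0.2679 : ℝ) < ratio := by unfold ratio; linarith [sqrt_three_lt]

theorem ratio_lt : ratio < (0.268 : ℝ) := by unfold ratio; linarith [sqrt_three_gt]

theorem ratio_pos : 0 < ratio := by linarith [ratio_gt]

theorem ratio_pow_pos (n : ℕ) : 0 < ratio ^ n := pow_pos ratio_pos n

/-- The unit vector in direction `k * π / 6`, indexed cyclically. -/
def om (k : Fin 12) : ℂ := unitVector k

theorem unitVector_eq_pow (k : ℕ) : unitVector k = unitVector 1 ^ k := by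
  unfold unitVector
  rw [← Complex.exp_nat_mul]
  congr 1
  push_cast
  ring

theorem unitVector_one : unitVector 1 = ⟨Real.sqrt 3 / 2, 1 / 2⟩ := by
  unfold unitVector
  rw [Complex.exp_mul_I]
  apply Complex.ext
  · simp [← Complex.ofReal_cos, ← Complex.ofReal_sin, -Complex.ofReal_div, -Complex.ofReal_mul]
  · simp [← Complex.ofReal_cos, ← Complex.ofReal_sin, -Complex.ofReal_div, -Complex.ofReal_mul]

theorem unitVector_twelve : unitVector 12 = 1 := by
  unfold unitVector
  rw [← Complex.exp_two_pi_mul_I]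
  congr 1
  push_cast
  ring

theorem unitVector_mod (k : ℕ) : unitVector (k % 12) = unitVector k := by
  rw [unitVector_eq_pow, unitVector_eq_pow k]
  refine (pow_eq_pow_mod k ?_).symm
  rw [← unitVector_eq_pow, unitVector_twelve]

theorem om_add (j k : Fin 12) : om (j + k) = om j * om k := by
  unfold om
  rw [Fin.val_add, unitVector_mod, unitVector_eq_pow, unitVector_eq_pow j, unitVector_eq_pow k,
    pow_add]

theorem om_zero : om 0 = 1 := by
  unfold om
  rw [unitVector_eq_pow]; simp

theorem om_neg_mul (k : Fin 12) : om (-k) * om k = 1 := by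
  rw [← om_add, neg_add_cancel, om_zero]

theorem om_succ_eq (k : Fin 12) : unitVector ((k : ℕ) + 1 : ℕ) = om (k + 1) := by
  unfold om
  rw [Fin.val_add, unitVector_mod]; rfl

theorem norm_om (k : Fin 12) : ‖om k‖ = 1 := Complex.norm_exp_ofReal_mul_I _

theorem om_ne_zero (k : Fin 12) : om k ≠ 0 := by
  intro h; have := norm_om k; rw [h] at this; simp at this

/-- Multiplication by the primitive twelfth root of unity `ζ` in the coordinates
`a + b ζ + c ζ ^ 2 + d ζ ^ 3`. -/
def mulZeta (p : ℤ × ℤ × ℤ × ℤ) : ℤ × ℤ × ℤ × ℤ :=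
  (-p.2.2.2, p.1, p.2.1 + p.2.2.2, p.2.2.1)

/-- Multiplication by `2 - √3` in the coordinates `a + b ζ + c ζ ^ 2 + d ζ ^ 3`. -/
def mulRatio (p : ℤ × ℤ × ℤ × ℤ) : ℤ × ℤ × ℤ × ℤ :=
  -- Here `√3 = 2 ζ - ζ ^ 3`.
  p + p - (mulZeta p + mulZeta p - mulZeta^[3] p)

/-- The complex number `a + b ζ + c ζ ^ 2 + d ζ ^ 3`. -/
def toC (p : ℤ × ℤ × ℤ × ℤ) : ℂ :=
  ⟨(2 * p.1 + p.2.2.1 + p.2.1 * Real.sqrt 3) / 2,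
    (p.2.1 + 2 * p.2.2.2 + p.2.2.1 * Real.sqrt 3) / 2⟩

theorem toC_add (p q : ℤ × ℤ × ℤ × ℤ) : toC (p + q) = toC p + toC q := by
  apply Complex.ext <;> simp [toC] <;> ring

theorem toC_sub (p q : ℤ × ℤ × ℤ × ℤ) : toC (p - q) = toC p - toC q := by
  apply Complex.ext <;> simp [toC] <;> ring

theorem toC_mulZeta (p : ℤ × ℤ × ℤ × ℤ) : toC (mulZeta p) = unitVector 1 * toC p := by
  rw [unitVector_one]
  apply Complex.ext <;> simp [toC, mulZeta] <;> ring_nf <;>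
    rw [Real.sq_sqrt (by norm_num)] <;> ring

theorem toC_mulZeta_iterate (k : ℕ) (p : ℤ × ℤ × ℤ × ℤ) :
    toC (mulZeta^[k] p) = unitVector k * toC p := by
  induction k with
  | zero => rw [unitVector_eq_pow]; simp
  | succ k ih =>
    rw [Function.iterate_succ_apply', toC_mulZeta, ih, unitVector_eq_pow k,
      unitVector_eq_pow (k + 1), pow_succ]
    ring

theorem toC_om_mul (k : Fin 12) (p : ℤ × ℤ × ℤ × ℤ) :
    toC (mulZeta^[(k : ℕ)] p) = om k * toC p := toC_mulZeta_iterate _ _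

theorem toC_mulRatio (p : ℤ × ℤ × ℤ × ℤ) : toC (mulRatio p) = ratio * toC p := by
  unfold mulRatio
  simp only [toC_sub, toC_add, toC_mulZeta_iterate 3, toC_mulZeta]
  rw [unitVector_eq_pow 3, unitVector_one]
  have h := sqrt_three_sq
  have h2 : Real.sqrt 3 ^ 2 = 3 := Real.sq_sqrt (by norm_num)
  have h3 : (⟨Real.sqrt 3 / 2, 1 / 2⟩ : ℂ) ^ 3 = Complex.I := by
    rw [pow_succ, pow_two]
    have h4 : Real.sqrt 3 ^ 3 = 3 * Real.sqrt 3 := by rw [pow_succ, h2]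
    apply Complex.ext <;> simp <;> ring_nf <;> simp only [h2, h4] <;> ring
  rw [h3]
  apply Complex.ext <;> simp [ratio] <;> ring

theorem toC_one : toC (1, 0, 0, 0) = 1 := by
  apply Complex.ext <;> simp [toC]

theorem toC_om (k : Fin 12) : om k = toC (mulZeta^[(k : ℕ)] (1, 0, 0, 0)) := by
  rw [toC_om_mul, toC_one, mul_one]

/-- A decidable sufficient criterion for `0 < x + y √3`. -/
def SurdPos (x y : ℤ) : Prop :=
  (0 ≤ y ∧ 0 < 1000 * x + 1732 * y) ∨ (y ≤ 0 ∧ 0 < 10000 * x + 17321 * y)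

instance (x y : ℤ) : Decidable (SurdPos x y) := by unfold SurdPos; infer_instance

/-- The bounds `1.732 < √3 < 1.7321` suffice, the sign of `y` telling which one to use. Metric facts
about vertices thus become integer checks for `decide`. -/
theorem SurdPos.pos {x y : ℤ} (h : SurdPos x y) : 0 < (x : ℝ) + y * Real.sqrt 3 := by
  rcases h with ⟨h1, h2⟩ | ⟨h1, h2⟩
  · have h1' : (0 : ℝ) ≤ y := by exact_mod_cast h1
    have h2' : (0 : ℝ) < 1000 * x + 1732 * y := by exact_mod_cast h2
    nlinarith [sqrt_three_gt]
  · have h1' : (y : ℝ) ≤ 0 := by exact_mod_cast h1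
    have h2' : (0 : ℝ) < 10000 * x + 17321 * y := by exact_mod_cast h2
    nlinarith [sqrt_three_lt]

/-- Twice the real part of `toC p` is `reX p + reY p * √3`. -/
def reX (p : ℤ × ℤ × ℤ × ℤ) : ℤ := 2 * p.1 + p.2.2.1

/-- Twice the real part of `toC p` is `reX p + reY p * √3`. -/
def reY (p : ℤ × ℤ × ℤ × ℤ) : ℤ := p.2.1

theorem two_mul_re_toC (p : ℤ × ℤ × ℤ × ℤ) :
    2 * (toC p).re = (reX p : ℝ) + reY p * Real.sqrt 3 := by
  simp [toC, reX, reY]; ring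

/-- Four times the square of the norm of `toC p` is `sqX p + sqY p * √3`. -/
def sqX (p : ℤ × ℤ × ℤ × ℤ) : ℤ :=
  (2 * p.1 + p.2.2.1) ^ 2 + (p.2.1 + 2 * p.2.2.2) ^ 2 + 3 * p.2.1 ^ 2 + 3 * p.2.2.1 ^ 2

/-- Four times the square of the norm of `toC p` is `sqX p + sqY p * √3`. -/
def sqY (p : ℤ × ℤ × ℤ × ℤ) : ℤ :=
  2 * ((2 * p.1 + p.2.2.1) * p.2.1 + (p.2.1 + 2 * p.2.2.2) * p.2.2.1)

theorem four_mul_norm_sq_toC (p : ℤ × ℤ × ℤ × ℤ) :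
    4 * ‖toC p‖ ^ 2 = (sqX p : ℝ) + sqY p * Real.sqrt 3 := by
  rw [Complex.sq_norm, Complex.normSq_apply]
  simp only [toC, sqX, sqY]
  push_cast
  ring_nf
  rw [Real.sq_sqrt (by norm_num)]
  ring

/-! ### The vertices -/

/-- The vertices of the dodecagon of generation `0` in integer coordinates. -/
def vertexInt (k : Fin 12) : ℤ × ℤ × ℤ × ℤ := mulZeta^[(k : ℕ)] (1, 0, -1, 1)

/-- The vertices of the dodecagon of generation `0`. -/
def vert (k : Fin 12) : ℂ := om k * ⟨1 / 2, ratio / 2⟩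

theorem vert_eq_toC (k : Fin 12) : vert k = toC (vertexInt k) := by
  rw [vertexInt, toC_om_mul, vert]
  refine congrArg _ ?_
  apply Complex.ext <;> simp [toC, ratio] <;> ring

theorem vert_add (j k : Fin 12) : vert (j + k) = om j * vert k := by
  unfold vert; rw [om_add]; ring

/-- Double angle formulas at `π / 6`. This ties the trigonometric vertices to coordinates in `ℤ[ζ]`.
-/
theorem tan_pi_div_twelve : Real.sin (Real.pi / 12) = ratio * Real.cos (Real.pi / 12) := by
  have hs : 0 < Real.cos (Real.pi / 12) :=
    Real.cos_pos_of_mem_Ioo ⟨by linarith [Real.pi_pos], by linarith [Real.pi_pos]⟩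
  have h1 : Real.cos (Real.pi / 6) = 2 * Real.cos (Real.pi / 12) ^ 2 - 1 := by
    rw [← Real.cos_two_mul]; congr 1; ring
  have h2 : Real.sin (Real.pi / 6) = 2 * Real.sin (Real.pi / 12) * Real.cos (Real.pi / 12) := by
    rw [← Real.sin_two_mul]; congr 1; ring
  rw [Real.cos_pi_div_six] at h1
  rw [Real.sin_pi_div_six] at h2
  have h3 := sqrt_three_sq
  refine mul_right_cancel₀ hs.ne' ?_
  unfold ratio
  nlinarith

theorem vertexVector_eq (n : ℕ) (k : Fin 12) : vertexVector n k = (ratio ^ n : ℝ) * vert k := by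
  have hs : 0 < Real.cos (Real.pi / 12) :=
    Real.cos_pos_of_mem_Ioo ⟨by linarith [Real.pi_pos], by linarith [Real.pi_pos]⟩
  have h : Complex.exp (((2 * (k : ℕ) + 1 : ℝ) * Real.pi / 12 : ℝ) * Complex.I) =
      om k * Complex.exp ((Real.pi / 12 : ℝ) * Complex.I) := by
    unfold om unitVector
    rw [← Complex.exp_add]
    congr 1
    push_cast
    ring
  have h2 : Complex.exp ((Real.pi / 12 : ℝ) * Complex.I) =
      ((2 * Real.cos (Real.pi / 12) : ℝ) : ℂ) * ⟨1 / 2, ratio / 2⟩ := by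
    rw [Complex.exp_mul_I, ← Complex.ofReal_cos, ← Complex.ofReal_sin, tan_pi_div_twelve]
    generalize Real.cos (Real.pi / 12) = y
    apply Complex.ext
    · simp; ring
    · simp; ring
  unfold vertexVector
  rw [h, h2]
  unfold vert
  have : (((2 - Real.sqrt 3) ^ n / (2 * Real.cos (Real.pi / 12)) : ℝ) : ℂ) *
      ((2 * Real.cos (Real.pi / 12) : ℝ) : ℂ) = (ratio ^ n : ℝ) := by
    rw [← Complex.ofReal_mul]
    congr 1
    rw [ratio]
    field_simp
  rw [← this]
  ring

/-- The component of `z` in direction `j * π / 6`. -/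
def comp (j : Fin 12) (z : ℂ) : ℝ := (z * om (-j)).re

theorem comp_add (j : Fin 12) (z w : ℂ) : comp j (z + w) = comp j z + comp j w := by
  simp [comp, add_mul]

theorem comp_sub (j : Fin 12) (z w : ℂ) : comp j (z - w) = comp j z - comp j w := by
  simp [comp, sub_mul]

theorem comp_zero (j : Fin 12) : comp j 0 = 0 := by simp [comp]

theorem comp_smul (j : Fin 12) (r : ℝ) (z : ℂ) : comp j (r * z) = r * comp j z := by
  simp [comp, mul_assoc]

theorem comp_om_mul (i j : Fin 12) (z : ℂ) : comp j (om i * z) = comp (j - i) z := by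
  unfold comp
  rw [neg_sub, sub_eq_add_neg, om_add]
  congr 1; ring

theorem comp_vert_add (i j k : Fin 12) : comp j (vert (i + k)) = comp (j - i) (vert k) := by
  rw [vert_add, comp_om_mul]

theorem continuous_comp (j : Fin 12) : Continuous (comp j) := by
  unfold comp; fun_prop

theorem comp_le_norm (j : Fin 12) (z : ℂ) : comp j z ≤ ‖z‖ := by
  refine (Complex.re_le_norm _).trans ?_
  rw [norm_mul, norm_om, mul_one]

theorem comp_zero_eq (z : ℂ) : comp 0 z = z.re := by simp [comp, om_zero]

theorem comp_toC (j : Fin 12) (p : ℤ × ℤ × ℤ × ℤ) :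
    comp j (toC p) = (toC (mulZeta^[((-j : Fin 12) : ℕ)] p)).re := by
  rw [toC_om_mul, comp, mul_comm]

theorem om_six : om 6 = -1 := by
  rw [toC_om]
  apply Complex.ext <;> simp [toC, mulZeta]

theorem om_one : om 1 = ⟨Real.sqrt 3 / 2, 1 / 2⟩ := unitVector_one

theorem comp_add_six (j : Fin 12) (z : ℂ) : comp (j + 6) z = -comp j z := by
  unfold comp
  rw [neg_add, om_add]
  have : om (-6) = -1 := om_six
  rw [this]; simp

/-- Directions `j` and `j + 3` are perpendicular, so these components are orthonormal coordinates;
the other components are computed from them. -/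
theorem comp_eq_of_zero_three (j : Fin 12) (z : ℂ) :
    z = (comp j z + comp (j + 3) z * Complex.I) * om j := by
  have h3 : om (-3) = - Complex.I := by
    rw [toC_om]
    apply Complex.ext <;> simp [toC, mulZeta, show ((-3 : Fin 12) : ℕ) = 9 from rfl]
  have h : (z * om (-j)) = (comp j z + comp (j + 3) z * Complex.I) := by
    unfold comp
    rw [neg_add, om_add, h3]
    apply Complex.ext
    · simp
    · simp; ring
  rw [← h, mul_assoc, om_neg_mul, mul_one]

theorem comp_add_one (j : Fin 12) (z : ℂ) :
    comp (j + 1) z = Real.sqrt 3 / 2 * comp j z + 1 / 2 * comp (j + 3) z := by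
  conv_lhs => rw [comp_eq_of_zero_three j z, mul_comm, comp_om_mul, add_sub_cancel_left]
  have h1 : om (-1) = ⟨Real.sqrt 3 / 2, -1 / 2⟩ := by
    rw [toC_om]
    apply Complex.ext <;> simp [toC, mulZeta, show ((-1 : Fin 12) : ℕ) = 11 from rfl]; norm_num
  rw [comp, h1]
  simp; ring

theorem comp_add_four (j : Fin 12) (z : ℂ) :
    comp (j + 4) z = - 1 / 2 * comp j z + Real.sqrt 3 / 2 * comp (j + 3) z := by
  conv_lhs => rw [comp_eq_of_zero_three j z, mul_comm, comp_om_mul, add_sub_cancel_left]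
  have h1 : om (-4) = ⟨-1 / 2, -Real.sqrt 3 / 2⟩ := by
    rw [toC_om]
    apply Complex.ext <;> simp [toC, mulZeta, show ((-4 : Fin 12) : ℕ) = 8 from rfl]
  rw [comp, h1]
  simp; ring

theorem norm_sq_eq_comp (j : Fin 12) (z : ℂ) :
    ‖z‖ ^ 2 = comp j z ^ 2 + comp (j + 3) z ^ 2 := by
  conv_lhs => rw [comp_eq_of_zero_three j z, norm_mul, norm_om, mul_one, Complex.sq_norm,
    Complex.normSq_apply]
  simp; ring

theorem norm_sq_vert (k : Fin 12) : ‖vert k‖ ^ 2 = ratio := by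
  rw [vert, norm_mul, norm_om, one_mul, Complex.sq_norm, Complex.normSq_apply]
  have := sqrt_three_sq
  simp only [ratio]
  nlinarith

theorem norm_vert_lt (k : Fin 12) : ‖vert k‖ < 0.5177 := by
  refine lt_of_pow_lt_pow_left₀ 2 (by norm_num) ?_
  rw [norm_sq_vert]
  linarith [ratio_lt]

theorem norm_vert_gt (k : Fin 12) : 0.517 < ‖vert k‖ := by
  refine lt_of_pow_lt_pow_left₀ 2 (norm_nonneg _) ?_
  rw [norm_sq_vert]
  linarith [ratio_gt]

/-! ### Finite verifications -/

/-- The integer coordinates of `toC p * om (-j)`. -/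
def turn (j : Fin 12) (p : ℤ × ℤ × ℤ × ℤ) : ℤ × ℤ × ℤ × ℤ := mulZeta^[((-j : Fin 12) : ℕ)] p

theorem two_mul_comp_toC (j : Fin 12) (p : ℤ × ℤ × ℤ × ℤ) :
    2 * comp j (toC p) = (reX (turn j p) : ℝ) + reY (turn j p) * Real.sqrt 3 := by
  rw [comp_toC, two_mul_re_toC]; rfl

theorem comp_zero_vert_cases : ∀ k : Fin 12, comp 0 (vert k) =
    ![1 / 2, (Real.sqrt 3 - 1) / 2, ratio / 2, - ratio / 2, -(Real.sqrt 3 - 1) / 2, -1 / 2,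
      -1 / 2, -(Real.sqrt 3 - 1) / 2, - ratio / 2, ratio / 2, (Real.sqrt 3 - 1) / 2, 1 / 2] k := by
  intro k
  have h := two_mul_comp_toC 0 (vertexInt k)
  rw [← vert_eq_toC] at h
  have hx : reX (turn 0 (vertexInt k)) =
      ![1, -1, 2, -2, 1, -1, -1, 1, -2, 2, -1, 1] k := by clear h; decide +revert
  have hy : reY (turn 0 (vertexInt k)) =
      ![0, 1, -1, 1, -1, 0, 0, -1, 1, -1, 1, 0] k := by clear h hx; decide +revert
  rw [hx, hy] at h
  fin_cases k <;> simp [ratio] at h ⊢ <;> linarith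

theorem comp_zero_vert_le (k : Fin 12) : comp 0 (vert k) ≤ 1 / 2 := by
  rw [comp_zero_vert_cases]
  have h1 := sqrt_three_lt
  have h2 := sqrt_three_gt
  fin_cases k <;> simp [ratio] <;> linarith

theorem comp_zero_vert_ne (k : Fin 12) : comp 0 (vert k) ≠ 0 := by
  rw [comp_zero_vert_cases]
  have h1 := sqrt_three_lt
  have h2 := sqrt_three_gt
  fin_cases k <;> simp [ratio] <;> intro h <;> linarith

theorem comp_vert (j k : Fin 12) : comp j (vert k) = comp 0 (vert (k - j)) := by
  conv_lhs => rw [← add_sub_cancel j k, comp_vert_add, sub_self]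

theorem comp_vert_le (j k : Fin 12) : comp j (vert k) ≤ 1 / 2 := by
  rw [comp_vert]; exact comp_zero_vert_le _

/-- Vertices point in odd multiples of `π / 12`, which are never perpendicular to a multiple of `π /
6`. Hence rays in vertex directions are transversal to all lines bounding pieces. -/
theorem comp_vert_ne (j k : Fin 12) : comp j (vert k) ≠ 0 := by
  rw [comp_vert]; exact comp_zero_vert_ne _

/-- The last alternative encodes `4 ‖·‖ ^ 2 > 63 - 36 √3 = 9 (2 - √3) ^ 2`, that is, a norm above `3
/ 2 * ratio`. -/
theorem sub_vert_int : ∀ d : Fin 12, d = 0 ∨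
    (∃ i : Fin 12, vertexInt d - vertexInt 0 = mulZeta^[(i : ℕ)] (mulRatio (1, 0, 0, 0))) ∨
    SurdPos (sqX (vertexInt d - vertexInt 0) - 63) (sqY (vertexInt d - vertexInt 0) + 36) := by
  decide

theorem one_add_sub_vert_int : ∀ k l : Fin 12,
    (1, 0, 0, 0) + vertexInt l - vertexInt k = 0 ∨
    (∃ i : Fin 12,
      (1, 0, 0, 0) + vertexInt l - vertexInt k = mulZeta^[(i : ℕ)] (mulRatio (1, 0, 0, 0))) ∨
    SurdPos (sqX ((1, 0, 0, 0) + vertexInt l - vertexInt k) - 63)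
      (sqY ((1, 0, 0, 0) + vertexInt l - vertexInt k) + 36) := by
  decide +kernel

theorem toC_zero : toC 0 = 0 := by
  apply Complex.ext <;> simp [toC]

theorem toC_step (i : Fin 12) :
    toC (mulZeta^[(i : ℕ)] (mulRatio (1, 0, 0, 0))) = ratio * om i := by
  rw [toC_om_mul, toC_mulRatio, toC_one]; ring

theorem ratio_le_norm_of_surdPos {p : ℤ × ℤ × ℤ × ℤ} (h : SurdPos (sqX p - 63) (sqY p + 36)) :
    3 / 2 * ratio ≤ ‖toC p‖ := by
  have h1 := h.pos
  have h2 := four_mul_norm_sq_toC p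
  have h3 := sqrt_three_sq
  push_cast at h1
  refine le_of_sq_le_sq ?_ (norm_nonneg _)
  unfold ratio
  nlinarith

theorem vert_sub_vert (k l : Fin 12) : k = l ∨ (∃ i, vert l - vert k = ratio * om i) ∨
    3 / 2 * ratio ≤ ‖vert l - vert k‖ := by
  have h : vert l - vert k = om k * toC (vertexInt (l - k) - vertexInt 0) := by
    rw [toC_sub, ← vert_eq_toC, ← vert_eq_toC, mul_sub, ← vert_add, ← vert_add]
    simp
  rcases sub_vert_int (l - k) with h1 | ⟨i, h1⟩ | h1
  · left; exact (sub_eq_zero.1 h1).symm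
  · right; left
    refine ⟨k + i, ?_⟩
    rw [h, h1, toC_step, om_add]; ring
  · right; right
    rw [h, norm_mul, norm_om, one_mul]
    exact ratio_le_norm_of_surdPos h1

theorem om_add_vert_sub_vert (j k l : Fin 12) : om j + vert l - vert k = 0 ∨
    (∃ i, om j + vert l - vert k = ratio * om i) ∨
    3 / 2 * ratio ≤ ‖om j + vert l - vert k‖ := by
  have h : om j + vert l - vert k =
      om j * toC ((1, 0, 0, 0) + vertexInt (l - j) - vertexInt (k - j)) := by
    rw [toC_sub, toC_add, toC_one, ← vert_eq_toC, ← vert_eq_toC, mul_sub, mul_add, ← vert_add,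
      ← vert_add]
    simp
  rcases one_add_sub_vert_int (k - j) (l - j) with h1 | ⟨i, h1⟩ | h1
  · left; rw [h, h1, toC_zero, mul_zero]
  · right; left
    refine ⟨j + i, ?_⟩
    rw [h, h1, toC_step, om_add]; ring
  · right; right
    rw [h, norm_mul, norm_om, one_mul]
    exact ratio_le_norm_of_surdPos h1

theorem norm_sub_vert_int : ∀ d : Fin 12, d = 5 ∨ d = 7 ∨
    SurdPos (sqX (vertexInt d - vertexInt 0) - 4) (sqY (vertexInt d - vertexInt 0)) ∨
    SurdPos (4 - sqX (vertexInt d - vertexInt 0)) (- sqY (vertexInt d - vertexInt 0)) := by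
  decide

/-- Only the index differences 5 and 7 give two vertices at distance 1; in all other cases the
squared distance lies strictly on one side of 1. -/
theorem eq_add_of_vert_sub_vert {j k l : Fin 12} (h : vert l - vert k = om j) :
    l = k + 5 ∨ l = k + 7 := by
  have h' : vert l - vert k = om k * toC (vertexInt (l - k) - vertexInt 0) := by
    rw [toC_sub, ← vert_eq_toC, ← vert_eq_toC, mul_sub, ← vert_add, ← vert_add]
    simp
  have hn : ‖toC (vertexInt (l - k) - vertexInt 0)‖ = 1 := by
    have := congrArg norm h
    rwa [h', norm_mul, norm_om, norm_om, one_mul] at this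
  have h4 := four_mul_norm_sq_toC (vertexInt (l - k) - vertexInt 0)
  rw [hn] at h4
  rcases norm_sub_vert_int (l - k) with h1 | h1 | h1 | h1
  · left; rw [← h1, add_sub_cancel]
  · right; rw [← h1, add_sub_cancel]
  · have := h1.pos; push_cast at this; linarith
  · have := h1.pos; push_cast at this; linarith

theorem vert_add_five (k : Fin 12) : vert k - vert (k + 5) = om k := by
  have h : vert 0 - vert 5 = 1 := by
    rw [vert_eq_toC, vert_eq_toC, ← toC_sub, ← toC_one]; congr 1
  conv_lhs => rw [← add_zero k, vert_add, add_zero, vert_add, ← mul_sub, h, mul_one]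

theorem vert_add_seven (k : Fin 12) : vert k - vert (k + 7) = om (k + 1) := by
  have h : vert 0 - vert 7 = om 1 := by
    rw [vert_eq_toC, vert_eq_toC, ← toC_sub, toC_om]; congr 1
  conv_lhs => rw [← add_zero k, vert_add, add_zero, vert_add, ← mul_sub, h, ← om_add]

theorem vert_succ (k : Fin 12) : vert (k + 1) - vert k = ratio * om (k + 4) := by
  have h : vert 1 - vert 0 = ratio * om 4 := by
    rw [vert_eq_toC, vert_eq_toC, ← toC_sub, ← toC_step]; congr 1
  rw [vert_add]
  conv_lhs => rw [← add_zero k, vert_add, add_zero, ← mul_sub, h]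
  rw [om_add]; ring

theorem vert_pred (k : Fin 12) : vert (k - 1) - vert k = ratio * om (k + 9) := by
  have h := vert_succ (k - 1)
  rw [sub_add_cancel] at h
  have h6 : om (k + 9) = - om (k - 1 + 4) := by
    rw [show k + 9 = k - 1 + 4 + 6 by clear h; decide +revert, om_add _ 6, om_six]; ring
  rw [h6, mul_neg, ← h]; ring

/-- The surd inequality says that five times twice the component exceeds `5 + 8 (2 - √3)`, so the
component exceeds `1 / 2 + 4 / 5 * ratio`. -/
theorem separated_vert_int : ∀ k : Fin 12, (∃ l, (1, 0, 0, 0) + vertexInt k = vertexInt l) ∨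
    ∃ i : Fin 12, SurdPos (5 * reX (turn i ((1, 0, 0, 0) + vertexInt k)) - 5 - 16)
      (5 * reY (turn i ((1, 0, 0, 0) + vertexInt k)) + 8) := by
  decide

theorem separated_vert (j k : Fin 12) : (∃ l, om j + vert k = vert l) ∨
    ∃ i, 1 / 2 + 4 / 5 * ratio ≤ comp i (om j + vert k) := by
  have h : om j + vert k = om j * toC ((1, 0, 0, 0) + vertexInt (k - j)) := by
    rw [toC_add, toC_one, ← vert_eq_toC, mul_add, ← vert_add]; simp
  rcases separated_vert_int (k - j) with ⟨l, h1⟩ | ⟨i, h1⟩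
  · left
    refine ⟨j + l, ?_⟩
    rw [h, h1, ← vert_eq_toC, vert_add]
  · right
    refine ⟨i + j, ?_⟩
    rw [h, comp_om_mul, add_sub_cancel_right]
    have h2 := h1.pos
    have h3 := two_mul_comp_toC i ((1, 0, 0, 0) + vertexInt (k - j))
    push_cast at h2
    unfold ratio
    linarith

/-- With `ratio ^ 2 = 7 - 4 √3`, the surd inequality bounds four times the component by `2 - 3 *
ratio ^ 2`. -/
theorem inner_vert_int : ∀ d j : Fin 12, d = 5 ∨ d = 6 ∨ d = 7 →
    SurdPos (2 - 2 * reX (turn j (vertexInt 0 + mulRatio (vertexInt d))) - 21)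
      (- 2 * reY (turn j (vertexInt 0 + mulRatio (vertexInt d))) + 12) := by
  decide

theorem inner_vert {i k : Fin 12} (h : k = i + 5 ∨ k = i + 6 ∨ k = i + 7) (j : Fin 12) :
    comp j (vert i + ratio * vert k) + 3 / 4 * ratio ^ 2 ≤ 1 / 2 := by
  have hd : k - i = 5 ∨ k - i = 6 ∨ k - i = 7 := by
    rcases h with h | h | h <;> subst h <;> simp
  have h1 := (inner_vert_int (k - i) (j - i) hd).pos
  have h2 := two_mul_comp_toC (j - i) (vertexInt 0 + mulRatio (vertexInt (k - i)))
  have h3 : vert i + ratio * vert k =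
      om i * toC (vertexInt 0 + mulRatio (vertexInt (k - i))) := by
    rw [toC_add, toC_mulRatio, ← vert_eq_toC, ← vert_eq_toC, mul_add, ← vert_add, add_zero,
      mul_left_comm, ← vert_add]
    simp
  rw [h3, comp_om_mul]
  push_cast at h1
  unfold ratio
  nlinarith [sqrt_three_sq]

/-! ### Dodecagons and their pieces -/

theorem vertexVector_comp_le (n : ℕ) (j k : Fin 12) :
    comp j (vertexVector n k) ≤ ratio ^ n / 2 := by
  rw [vertexVector_eq, comp_smul]
  have := mul_le_mul_of_nonneg_left (comp_vert_le j k) (ratio_pow_pos n).le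
  linarith

theorem om_eq_vert_add (k : Fin 12) : om k = vert k + vert (k - 1) := by
  have h : vert 0 + vert 11 = 1 := by
    rw [vert_eq_toC, vert_eq_toC, ← toC_add, ← toC_one]; congr 1
  have h11 : vert (k - 1) = om k * vert 11 := by rw [← vert_add]; congr 1; clear * -; decide +revert
  have h0 : vert k = om k * vert 0 := by rw [← vert_add]; congr 1; simp
  rw [h0, h11, ← mul_add, h, mul_one]

theorem om_add_om (k : Fin 12) : vert k = ratio * (om k + om (k + 1)) := by
  have h : vert 0 = ratio * (1 + om 1) := by
    rw [vert_eq_toC, om_one]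
    apply Complex.ext <;> simp [toC, vertexInt, ratio] <;> ring_nf
    norm_num [Real.sq_sqrt]
  have h0 : vert k = om k * vert 0 := by rw [← vert_add]; congr 1; simp
  rw [h0, h, om_add]; ring

theorem mem_of_convex_three {S : Set ℂ} (hS : Convex ℝ S) {p q r : ℂ} (hp : p ∈ S) (hq : q ∈ S)
    (hr : r ∈ S) {a b c : ℝ} (ha : 0 ≤ a) (hb : 0 ≤ b) (hc : 0 ≤ c) (h : a + b + c = 1) :
    a * p + b * q + c * r ∈ S := by
  have := hS.sum_mem (t := Finset.univ) (w := ![a, b, c]) (z := ![p, q, r])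
    (by intro i _; fin_cases i <;> simpa) (by simpa [Fin.sum_univ_three] using h)
    (by intro i _; fin_cases i <;> simpa)
  simpa [Fin.sum_univ_three] using this

theorem comp_eq_cone (i k : Fin 12) (s t : ℝ) :
    comp i (s * om k + t * om (k + 1)) = s * (om (k - i)).re + t * (om (k + 1 - i)).re := by
  rw [comp_add, comp_smul, comp_smul]
  simp only [comp, ← om_add, sub_eq_add_neg]

theorem om_re_cases : ∀ k : Fin 12, (om k).re =
    ![1, Real.sqrt 3 / 2, 1 / 2, 0, -1 / 2, -Real.sqrt 3 / 2, -1, -Real.sqrt 3 / 2, -1 / 2, 0,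
      1 / 2, Real.sqrt 3 / 2] k := by
  intro k
  have h := two_mul_re_toC (mulZeta^[(k : ℕ)] (1, 0, 0, 0))
  rw [← toC_om] at h
  have hx : reX (mulZeta^[(k : ℕ)] (1, 0, 0, 0)) =
      ![2, 0, 1, 0, -1, 0, -2, 0, -1, 0, 1, 0] k := by clear * -; decide +revert
  have hy : reY (mulZeta^[(k : ℕ)] (1, 0, 0, 0)) =
      ![0, 1, 0, 0, 0, -1, 0, -1, 0, 0, 0, 1] k := by clear * -; decide +revert
  rw [hx, hy] at h
  fin_cases k <;> simp at h ⊢ <;> linarith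

theorem eq_cone_coordinates (k : Fin 12) (u : ℂ) :
    u = ((-2 * comp (k + 4) u : ℝ) : ℂ) * om k + ((2 * comp (k + 3) u : ℝ) : ℂ) * om (k + 1) := by
  have h3 := sqrt_three_sq
  conv_lhs => rw [comp_eq_of_zero_three k u]
  rw [comp_add_four, om_add k 1, om_one]
  have : ((comp k u : ℂ) + comp (k + 3) u * Complex.I) =
      ((-2 * (- 1 / 2 * comp k u + Real.sqrt 3 / 2 * comp (k + 3) u) : ℝ) : ℂ) +
      ((2 * comp (k + 3) u : ℝ) : ℂ) * ⟨Real.sqrt 3 / 2, 1 / 2⟩ := by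
    apply Complex.ext <;> simp <;> ring
  rw [this]; ring

/-- Otherwise a nonnegative component in direction `j` would force positive ones in directions `j +
1`, ..., `j + 6`; but the last is the negative of the first. -/
theorem exists_cone (u : ℂ) : ∃ k : Fin 12, 0 ≤ comp (k + 3) u ∧ comp (k + 4) u ≤ 0 := by
  by_contra! h
  have hs : ∀ j : Fin 12, 0 ≤ comp j u → 0 < comp (j + 1) u := by
    intro j hj
    have := h (j - 3) (by rwa [sub_add_cancel])
    rwa [show j - 3 + 4 = j + 1 by clear * -; decide +revert] at this
  have hk : ∀ j : Fin 12, 0 ≤ comp j u → 0 < comp (j + 6) u := by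
    intro j hj
    have := hs _ (hs _ (hs _ (hs _ (hs _ (hs _ hj).le).le).le).le).le
    rwa [show j + 1 + 1 + 1 + 1 + 1 + 1 = j + 6 by clear * -; decide +revert] at this
  rcases le_total 0 (comp 0 u) with h0 | h0
  · have := hk 0 h0
    rw [comp_add_six] at this
    linarith
  · have h6 : 0 ≤ comp 6 u := by
      have := comp_add_six 0 u
      rw [zero_add] at this
      linarith
    have := hk 6 h6
    rw [show (6 + 6 : Fin 12) = 0 from rfl] at this
    linarith

theorem comp_le_of_mem_dodecagon {n : ℕ} {x z : ℂ} (hz : z ∈ dodecagon n x) (j : Fin 12) :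
    comp j (z - x) ≤ ratio ^ n / 2 := by
  have hc : Convex ℝ {z | comp j z ≤ comp j x + ratio ^ n / 2} := by
    refine convex_halfSpace_le ⟨comp_add j, fun c z => ?_⟩ _
    rw [Complex.real_smul, comp_smul, smul_eq_mul]
  have : z ∈ {z | comp j z ≤ comp j x + ratio ^ n / 2} := by
    refine convexHull_min ?_ hc hz
    rintro _ ⟨k, rfl⟩
    have := vertexVector_comp_le n j k
    change comp j (x + vertexVector n k) ≤ _
    rw [comp_add]; linarith
  have h2 : comp j z ≤ comp j x + ratio ^ n / 2 := this
  rw [comp_sub]; linarith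

theorem convex_dodecagon (n : ℕ) (x : ℂ) : Convex ℝ (dodecagon n x) := convex_convexHull ℝ _

theorem vertex_mem_dodecagon (n : ℕ) (x : ℂ) (k : Fin 12) : x + vertexVector n k ∈ dodecagon n x :=
  subset_convexHull ℝ _ ⟨k, rfl⟩

theorem vert_add_six (k : Fin 12) : vert (k + 6) = - vert k := by
  rw [add_comm, vert_add, om_six]; ring

theorem centre_mem_dodecagon (n : ℕ) (x : ℂ) : x ∈ dodecagon n x := by
  have h := mem_of_convex_three (convex_dodecagon n x) (vertex_mem_dodecagon n x 0)
    (vertex_mem_dodecagon n x 6) (vertex_mem_dodecagon n x 6) (a := 1 / 2) (b := 1 / 2) (c := 0)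
    (by norm_num) (by norm_num) le_rfl (by norm_num)
  have h6 : vert 6 = - vert 0 := vert_add_six 0
  rw [vertexVector_eq, vertexVector_eq, h6] at h
  convert h using 1
  push_cast; ring

/-- Within cone `k` only the two edges meeting at vertex `k` matter. The point is an explicit convex
combination of the centre, vertex `k` and a neighbouring vertex. -/
theorem mem_dodecagon_of_comp {n : ℕ} {x z : ℂ} {k : Fin 12} (h3 : 0 ≤ comp (k + 3) (z - x))
    (h4 : comp (k + 4) (z - x) ≤ 0) (h0 : comp k (z - x) ≤ ratio ^ n / 2)
    (h1 : comp (k + 1) (z - x) ≤ ratio ^ n / 2) : z ∈ dodecagon n x := by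
  have hr := ratio_pow_pos n
  have ht := ratio_pos
  have hinv : ratio * (2 + Real.sqrt 3) = 1 := by
    unfold ratio; linarith [sqrt_three_sq]
  have hs3 := sqrt_three_sq
  have h4' := comp_add_four k (z - x)
  have h1' := comp_add_one k (z - x)
  have hz := eq_cone_coordinates k (z - x)
  set s := -2 * comp (k + 4) (z - x) with hs
  set t := 2 * comp (k + 3) (z - x) with htt
  have hs0 : 0 ≤ s := by linarith
  have ht0 : 0 ≤ t := by linarith
  have hk : comp k (z - x) = s + Real.sqrt 3 / 2 * t := by rw [hs, htt, h4']; ring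
  have hk1 : comp (k + 1) (z - x) = Real.sqrt 3 / 2 * s + t := by
    rw [h1', hk, htt]
    nlinarith
  rw [hk] at h0
  rw [hk1] at h1
  have key : ∀ (a b : ℝ) (l : Fin 12), 0 ≤ a → 0 ≤ b → 2 * a + (2 + Real.sqrt 3) * b ≤ ratio ^ n →
      z - x = a * (vert k + vert l) + b * (2 + Real.sqrt 3 : ℝ) * vert k → z ∈ dodecagon n x := by
    intro a b l ha hb hab he
    have hb' : 0 ≤ (2 + Real.sqrt 3) * b := by positivity
    have := mem_of_convex_three (convex_dodecagon n x) (centre_mem_dodecagon n x)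
      (vertex_mem_dodecagon n x k) (vertex_mem_dodecagon n x l)
      (a := 1 - (2 * a + (2 + Real.sqrt 3) * b) / ratio ^ n)
      (b := (a + (2 + Real.sqrt 3) * b) / ratio ^ n) (c := a / ratio ^ n)
      (by rw [sub_nonneg, div_le_one hr]; exact hab) (by positivity) (by positivity)
      (by field_simp; ring)
    convert this using 1
    rw [vertexVector_eq, vertexVector_eq]
    have hrc : ((ratio ^ n : ℝ) : ℂ) ≠ 0 := by exact_mod_cast hr.ne'
    rw [← sub_eq_zero, show z = x + (z - x) by ring, he]
    push_cast at hrc ⊢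
    field_simp
    ring
  have hsum : om k + om (k + 1) = (2 + Real.sqrt 3 : ℝ) * vert k := by
    rw [om_add_om k, ← mul_assoc, ← Complex.ofReal_mul, mul_comm _ ratio, hinv]; simp
  -- The ray through vertex `k` bisects the cone: the neighbour needed is vertex `k - 1` on one side
  -- and vertex `k + 1` on the other.
  rcases le_total t s with hle | hle
  · refine key (s - t) t (k - 1) (by linarith) ht0 (by linarith) ?_
    rw [hz, ← om_eq_vert_add, mul_assoc, ← hsum]
    push_cast; ring
  · refine key (t - s) s (k + 1) (by linarith) hs0 (by linarith) ?_
    have := om_eq_vert_add (k + 1)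
    rw [add_sub_cancel_right] at this
    rw [hz, add_comm (vert k), ← this, mul_assoc, ← hsum]
    push_cast; ring

theorem mem_piece_iff {n : ℕ} {x z : ℂ} {k : Fin 12} : z ∈ piece n x k ↔
    0 ≤ comp (k + 3) (z - x) ∧ comp (k + 4) (z - x) ≤ 0 ∧ comp k (z - x) ≤ ratio ^ n / 2 ∧
      comp (k + 1) (z - x) ≤ ratio ^ n / 2 := by
  have hcone : z ∈ cone x (unitVector k) (unitVector (k + 1 : ℕ)) ↔
      0 ≤ comp (k + 3) (z - x) ∧ comp (k + 4) (z - x) ≤ 0 := by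
    rw [om_succ_eq]
    change z ∈ cone x (om k) (om (k + 1)) ↔ _
    constructor
    · rintro ⟨s, t, hs, ht, rfl⟩
      have e : x + s * om k + t * om (k + 1) - x = s * om k + t * om (k + 1) := by ring
      rw [e, comp_eq_cone, comp_eq_cone, om_re_cases, om_re_cases, om_re_cases, om_re_cases]
      rw [show k - (k + 3) = 9 by clear * -; decide +revert,
        show k + 1 - (k + 3) = 10 by clear * -; decide +revert,
        show k - (k + 4) = 8 by clear * -; decide +revert,
        show k + 1 - (k + 4) = 9 by clear * -; decide +revert]
      simp
      constructor <;> linarith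
    · rintro ⟨h3, h4⟩
      refine ⟨-2 * comp (k + 4) (z - x), 2 * comp (k + 3) (z - x), by linarith, by linarith, ?_⟩
      rw [add_assoc, ← eq_cone_coordinates]; ring
  constructor
  · rintro ⟨h1, h2⟩
    rw [hcone] at h2
    exact ⟨h2.1, h2.2, comp_le_of_mem_dodecagon h1 _, comp_le_of_mem_dodecagon h1 _⟩
  · rintro ⟨h1, h2, h3, h4⟩
    exact ⟨mem_dodecagon_of_comp h1 h2 h3 h4, hcone.2 ⟨h1, h2⟩⟩

theorem mem_dodecagon_iff {n : ℕ} {x z : ℂ} :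
    z ∈ dodecagon n x ↔ ∀ j, comp j (z - x) ≤ ratio ^ n / 2 := by
  refine ⟨fun h j => comp_le_of_mem_dodecagon h j, fun h => ?_⟩
  obtain ⟨k, h3, h4⟩ := exists_cone (z - x)
  exact mem_dodecagon_of_comp h3 h4 (h _) (h _)

theorem piece_subset_dodecagon (n : ℕ) (x : ℂ) (k : Fin 12) : piece n x k ⊆ dodecagon n x :=
  Set.inter_subset_left

theorem exists_mem_piece {n : ℕ} {x z : ℂ} (hz : z ∈ dodecagon n x) : ∃ k, z ∈ piece n x k := by
  obtain ⟨k, h3, h4⟩ := exists_cone (z - x)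
  exact ⟨k, mem_piece_iff.2 ⟨h3, h4, comp_le_of_mem_dodecagon hz _,
    comp_le_of_mem_dodecagon hz _⟩⟩

/-- The interior of a piece of a dodecagon. -/
def openPiece (n : ℕ) (x : ℂ) (k : Fin 12) : Set ℂ :=
  {z | 0 < comp (k + 3) (z - x) ∧ comp (k + 4) (z - x) < 0 ∧ comp k (z - x) < ratio ^ n / 2 ∧
    comp (k + 1) (z - x) < ratio ^ n / 2}

theorem isOpen_openPiece (n : ℕ) (x : ℂ) (k : Fin 12) : IsOpen (openPiece n x k) := by
  have h : ∀ j, Continuous fun z => comp j (z - x) := fun j =>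
    (continuous_comp j).comp (continuous_sub_right x)
  exact (isOpen_lt continuous_const (h _)).inter ((isOpen_lt (h _) continuous_const).inter
    ((isOpen_lt (h _) continuous_const).inter (isOpen_lt (h _) continuous_const)))

theorem openPiece_subset_piece (n : ℕ) (x : ℂ) (k : Fin 12) : openPiece n x k ⊆ piece n x k :=
  fun _ hz => mem_piece_iff.2 ⟨hz.1.le, hz.2.1.le, hz.2.2.1.le, hz.2.2.2.le⟩

theorem openPiece_subset_dodecagon (n : ℕ) (x : ℂ) (k : Fin 12) :
    openPiece n x k ⊆ dodecagon n x :=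
  (openPiece_subset_piece n x k).trans (piece_subset_dodecagon n x k)

theorem comp_vert_three (k : Fin 12) : 0 < comp (k + 3) (vert k) := by
  rw [comp_vert, comp_zero_vert_cases, show k - (k + 3) = 9 by decide +revert]
  simp [ratio_pos]

theorem comp_vert_four (k : Fin 12) : comp (k + 4) (vert k) < 0 := by
  rw [comp_vert, comp_zero_vert_cases, show k - (k + 4) = 8 by decide +revert]
  simp [neg_div, ratio_pos]

/-- The points of the segment from the centre to a vertex. -/
theorem add_smul_vert_mem_openPiece (n : ℕ) (x : ℂ) (k : Fin 12) {ε : ℝ} (h0 : 0 < ε)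
    (h1 : ε < ratio ^ n) : x + ε * vert k ∈ openPiece n x k := by
  have e : x + ε * vert k - x = ε * vert k := by ring
  have ha := comp_vert_three k
  have hb := comp_vert_four k
  have hc := comp_vert_le k k
  have hd := comp_vert_le (k + 1) k
  simp only [openPiece, Set.mem_ofPred_eq, e, comp_smul]
  refine ⟨by positivity, mul_neg_of_pos_of_neg h0 hb, ?_, ?_⟩ <;> nlinarith

/-- Contracting a piece slightly towards an interior point makes all four inequalities strict. -/
theorem piece_subset_closure_openPiece (n : ℕ) (x : ℂ) (k : Fin 12) :
    piece n x k ⊆ closure (openPiece n x k) := by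
  intro z hz
  have hr := ratio_pow_pos n
  have hp := add_smul_vert_mem_openPiece n x k (ε := ratio ^ n / 2) (by positivity) (by linarith)
  set p := x + ((ratio ^ n / 2 : ℝ) : ℂ) * vert k
  have ht : Filter.Tendsto (fun ε : ℝ => z + ε * (p - z)) (nhdsWithin 0 (Set.Ioo 0 1))
      (nhds z) := by
    have : Continuous fun ε : ℝ => z + ε * (p - z) := by fun_prop
    have h2 := (this.tendsto 0).mono_left (nhdsWithin_le_nhds (s := Set.Ioo 0 1))
    simpa using h2
  have : (nhdsWithin (0 : ℝ) (Set.Ioo 0 1)).NeBot := by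
    rw [← mem_closure_iff_nhdsWithin_neBot, closure_Ioo (by norm_num)]; simp
  refine mem_closure_of_tendsto ht ?_
  filter_upwards [self_mem_nhdsWithin] with ε hε
  rw [mem_piece_iff] at hz
  obtain ⟨a1, a2, a3, a4⟩ := hz
  obtain ⟨b1, b2, b3, b4⟩ := hp
  have e : z + ε * (p - z) - x = ((1 - ε : ℝ) : ℂ) * (z - x) + ε * (p - x) := by push_cast; ring
  have h1 : 0 < 1 - ε := by linarith [hε.2]
  have h2 := hε.1
  simp only [openPiece, Set.mem_ofPred_eq, e, comp_smul, comp_add]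
  refine ⟨?_, ?_, ?_, ?_⟩ <;> nlinarith

theorem eq_of_mem_openPiece_of_mem_piece {n : ℕ} {x z : ℂ} {j k : Fin 12}
    (hk : z ∈ openPiece n x k) (hj : z ∈ piece n x j) : j = k := by
  rw [mem_piece_iff] at hj
  obtain ⟨h3, h4, -, -⟩ := hk
  obtain ⟨h5, h6, -, -⟩ := hj
  by_contra hne
  rw [eq_cone_coordinates k (z - x), comp_eq_cone] at h5 h6
  have hs : 0 < -2 * comp (k + 4) (z - x) := by linarith
  have ht : 0 < 2 * comp (k + 3) (z - x) := by linarith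
  generalize -2 * comp (k + 4) (z - x) = s at *
  generalize 2 * comp (k + 3) (z - x) = t at *
  have hd : k - j ≠ 0 := sub_ne_zero.2 (Ne.symm hne)
  have e1 : k - (j + 3) = (k - j) + 9 := by clear * -; decide +revert
  have e2 : k + 1 - (j + 3) = (k - j) + 10 := by clear * -; decide +revert
  have e3 : k - (j + 4) = (k - j) + 8 := by clear * -; decide +revert
  have e4 : k + 1 - (j + 4) = (k - j) + 9 := by clear * -; decide +revert
  rw [e1, e2, om_re_cases, om_re_cases] at h5
  rw [e3, e4, om_re_cases, om_re_cases] at h6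
  have hs3 : 0 < Real.sqrt 3 := by positivity
  have hs1 := mul_pos hs hs3
  have ht1 := mul_pos ht hs3
  generalize k - j = d at *
  clear e1 e2 e3 e4 h3 h4
  fin_cases d <;> simp at h5 h6 hd <;> nlinarith

theorem norm_sub_le_of_mem_dodecagon {n : ℕ} {x z : ℂ} (hz : z ∈ dodecagon n x) :
    ‖z - x‖ ≤ 0.5177 * ratio ^ n := by
  have hc : Convex ℝ (Metric.closedBall x (0.5177 * ratio ^ n)) := convex_closedBall _ _
  have : z ∈ Metric.closedBall x (0.5177 * ratio ^ n) := by
    refine convexHull_min ?_ hc hz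
    rintro _ ⟨k, rfl⟩
    rw [mem_closedBall_iff_norm, add_sub_cancel_left, vertexVector_eq, norm_mul, Complex.norm_real,
      Real.norm_of_nonneg (ratio_pow_pos n).le, mul_comm]
    exact mul_le_mul_of_nonneg_right (norm_vert_lt k).le (ratio_pow_pos n).le
  rwa [mem_closedBall_iff_norm] at this

theorem isCompact_dodecagon (n : ℕ) (x : ℂ) : IsCompact (dodecagon n x) :=
  (Set.finite_range _).isCompact_convexHull ℝ

theorem isClosed_dodecagon (n : ℕ) (x : ℂ) : IsClosed (dodecagon n x) :=
  (isCompact_dodecagon n x).isClosed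

/-! ### The packings -/

theorem comp_om_self (j : Fin 12) : comp j (om j) = 1 := by
  have := comp_om_mul j j 1
  rw [mul_one, sub_self] at this
  rw [this, comp_zero_eq]; simp

theorem comp_lt_of_mem_openPiece {n : ℕ} {x z : ℂ} {k : Fin 12} (hz : z ∈ openPiece n x k)
    (j : Fin 12) : comp j (z - x) < ratio ^ n / 2 := by
  obtain ⟨ε, hε, hb⟩ := Metric.isOpen_iff.1 (isOpen_openPiece n x k) z hz
  have h1 : z + (ε / 2 : ℝ) * om j ∈ openPiece n x k := by
    apply hb
    rw [mem_ball_iff_norm, add_sub_cancel_left, norm_mul, norm_om, Complex.norm_real,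
      Real.norm_of_nonneg (by positivity)]
    linarith
  have h2 := comp_le_of_mem_dodecagon (openPiece_subset_dodecagon n x k h1) j
  rw [show z + (ε / 2 : ℝ) * om j - x = (z - x) + (ε / 2 : ℝ) * om j by ring, comp_add, comp_smul,
    comp_om_self] at h2
  linarith

/-! ### Separation of the centres -/

theorem mem_hexagonalLattice_iff {x : ℂ} :
    x ∈ hexagonalLattice ↔ ∃ a b : ℤ, x = toC (a, 0, b, 0) := by
  rw [hexagonalLattice, AddSubgroup.mem_closure_pair]
  have h : ∀ a b : ℤ, a • (1 : ℂ) + b • (⟨1 / 2, Real.sqrt 3 / 2⟩ : ℂ) = toC (a, 0, b, 0) := by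
    intro a b
    apply Complex.ext <;> simp [toC] <;> ring
  simp only [h, eq_comm]

theorem om_even_mem (j : Fin 12) (hj : Even (j : ℕ)) : om j ∈ hexagonalLattice := by
  rw [mem_hexagonalLattice_iff, toC_om]
  obtain ⟨a, b, h⟩ : ∃ a b : ℤ, mulZeta^[(j : ℕ)] (1, 0, 0, 0) = (a, 0, b, 0) := by
    fin_cases j <;> simp [mulZeta] at hj ⊢ <;> revert hj <;> decide
  exact ⟨a, b, by rw [h]⟩

theorem lattice_separated {x x' : ℂ} (hx : x ∈ hexagonalLattice) (hx' : x' ∈ hexagonalLattice) :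
    x = x' ∨ (∃ j, x' - x = om j) ∨ 3 / 2 ≤ ‖x' - x‖ := by
  obtain ⟨a, b, h⟩ := mem_hexagonalLattice_iff.1 (sub_mem hx' hx)
  have hn : ‖x' - x‖ ^ 2 = ((a ^ 2 + a * b + b ^ 2 : ℤ) : ℝ) := by
    have := four_mul_norm_sq_toC (a, 0, b, 0)
    rw [h]
    simp only [sqX, sqY] at this
    push_cast at this ⊢
    linarith
  by_cases h3 : 3 ≤ a ^ 2 + a * b + b ^ 2
  · right; right
    refine le_of_sq_le_sq ?_ (norm_nonneg _)
    rw [hn]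
    have : (3 : ℝ) ≤ ((a ^ 2 + a * b + b ^ 2 : ℤ) : ℝ) := by exact_mod_cast h3
    linarith
  · push Not at h3
    have ha1 : a ≤ 1 := by nlinarith [sq_nonneg (a + 2 * b)]
    have ha2 : -1 ≤ a := by nlinarith [sq_nonneg (a + 2 * b)]
    have hb1 : b ≤ 1 := by nlinarith [sq_nonneg (2 * a + b)]
    have hb2 : -1 ≤ b := by nlinarith [sq_nonneg (2 * a + b)]
    have key : ∀ j : Fin 12, mulZeta^[(j : ℕ)] (1, 0, 0, 0) = (a, 0, b, 0) →
        ∃ j, x' - x = om j := fun j hj => ⟨j, by rw [h, toC_om, hj]⟩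
    have : (a = 0 ∧ b = 0) ∨ ∃ j : Fin 12, mulZeta^[(j : ℕ)] (1, 0, 0, 0) = (a, 0, b, 0) := by
      clear * - h3 ha1 ha2 hb1 hb2
      interval_cases a <;> interval_cases b <;> first | (exfalso; revert h3; decide) | decide
    rcases this with ⟨rfl, rfl⟩ | ⟨j, hj⟩
    · left
      have h0 : x' - x = 0 := by
        rw [h]; apply Complex.ext <;> simp [toC]
      exact (sub_eq_zero.1 h0).symm
    · right; left; exact key j hj

theorem norm_vertexVector_lt (n : ℕ) (k : Fin 12) : ‖vertexVector n k‖ < 0.5177 * ratio ^ n := by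
  rw [vertexVector_eq, norm_mul, Complex.norm_real, Real.norm_of_nonneg (ratio_pow_pos n).le,
    mul_comm]
  exact mul_lt_mul_of_pos_right (norm_vert_lt k) (ratio_pow_pos n)

/-- Distinct centres either differ by an edge-sharing step or are clearly far apart, and this
trichotomy is inherited. Children of equal or edge-sharing parents are covered by the finite tables;
children of far parents stay far by the triangle inequality. -/
theorem centres_separated (n : ℕ) : ∀ {x x' : ℂ}, x ∈ centres n → x' ∈ centres n →
    x = x' ∨ (∃ j, x' - x = (ratio ^ n : ℝ) * om j) ∨ 3 / 2 * ratio ^ n ≤ ‖x' - x‖ := by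
  induction n with
  | zero =>
    intro x x' hx hx'
    simpa using lattice_separated hx hx'
  | succ n ih =>
    rintro _ _ ⟨x, hx, k, rfl⟩ ⟨y, hy, l, rfl⟩
    have hr := ratio_pow_pos n
    have hnorm : ∀ u : ℂ, ‖((ratio ^ n : ℝ) : ℂ) * u‖ = ratio ^ n * ‖u‖ := fun u => by
      rw [norm_mul, Complex.norm_real, Real.norm_of_nonneg hr.le]
    rcases ih hx hy with rfl | ⟨j, hj⟩ | h
    · have e : x + vertexVector n l - (x + vertexVector n k) =
          (ratio ^ n : ℝ) * (vert l - vert k) := by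
        rw [vertexVector_eq, vertexVector_eq]; ring
      rw [e]
      rcases vert_sub_vert k l with rfl | ⟨i, hi⟩ | h
      · left; rfl
      · right; left
        exact ⟨i, by rw [hi]; push_cast; ring⟩
      · right; right
        rw [hnorm, pow_succ]
        nlinarith
    · have e : y + vertexVector n l - (x + vertexVector n k) =
          (ratio ^ n : ℝ) * (om j + vert l - vert k) := by
        rw [vertexVector_eq, vertexVector_eq, show y = x + (y - x) by ring, hj]; ring
      rw [e]
      rcases om_add_vert_sub_vert j k l with h | ⟨i, hi⟩ | h
      · left
        rw [h, mul_zero, sub_eq_zero] at e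
        exact e.symm
      · right; left
        exact ⟨i, by rw [hi]; push_cast; ring⟩
      · right; right
        rw [hnorm, pow_succ]
        nlinarith
    · right; right
      have e : y - x = (y + vertexVector n l - (x + vertexVector n k)) +
        (vertexVector n k - vertexVector n l) := by ring
      have h1 := norm_add_le (y + vertexVector n l - (x + vertexVector n k))
        (vertexVector n k - vertexVector n l)
      have h2 := norm_sub_le (vertexVector n k) (vertexVector n l)
      have h3 := norm_vertexVector_lt n k
      have h4 := norm_vertexVector_lt n l
      rw [← e] at h1
      have h5 : ratio ^ (n + 1) < 0.268 * ratio ^ n := by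
        rw [pow_succ, mul_comm]
        exact mul_lt_mul_of_pos_right ratio_lt hr
      linarith

theorem pairwise_dist_centres (n : ℕ) :
    (centres n).Pairwise fun x y => ratio ^ n ≤ dist x y := by
  intro x hx y hy hne
  have hr := ratio_pow_pos n
  rw [dist_comm, dist_eq_norm]
  rcases centres_separated n hx hy with h | ⟨j, hj⟩ | h
  · exact absurd h hne
  · rw [hj, norm_mul, norm_om, mul_one, Complex.norm_real, Real.norm_of_nonneg hr.le]
  · linarith

theorem isClosed_centres (n : ℕ) : IsClosed (centres n) :=
  Metric.isClosed_of_pairwise_le_dist (ratio_pow_pos n) (pairwise_dist_centres n)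

theorem finite_centres_inter (n : ℕ) {K : Set ℂ} (hK : Bornology.IsBounded K) :
    (K ∩ centres n).Finite := by
  have : DiscreteTopology (centres n) := by
    refine DiscreteTopology.of_forall_le_dist (ratio_pow_pos n) ?_
    intro x y hne
    exact pairwise_dist_centres n x.2 y.2 (fun h => hne (Subtype.ext h))
  exact Metric.finite_isBounded_inter_isClosed this.isDiscrete hK (isClosed_centres n)

/-- Since `2 * 0.5177 < 3 / 2`, dodecagons with a common vertex have equal or edge-sharing centres;
in the latter case the two vertex vectors differ by a unit vector, up to scale. -/
theorem eq_vertex_of_eq {n : ℕ} {x x' : ℂ} {k k' : Fin 12} (hx : x ∈ centres n)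
    (hx' : x' ∈ centres n) (h : x + vertexVector n k = x' + vertexVector n k') :
    k' = k ∧ x = x' ∨ k' = k + 5 ∨ k' = k + 7 := by
  have hr := ratio_pow_pos n
  have hrc : ((ratio ^ n : ℝ) : ℂ) ≠ 0 := by exact_mod_cast hr.ne'
  have e : x - x' = vertexVector n k' - vertexVector n k := by linear_combination h
  rcases centres_separated n hx' hx with rfl | ⟨j, hj⟩ | h3
  · left
    refine ⟨?_, rfl⟩
    rw [sub_self, vertexVector_eq, vertexVector_eq, ← mul_sub] at e
    have e2 : vert k' - vert k = 0 := by
      rcases mul_eq_zero.1 e.symm with h | h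
      · exact absurd h hrc
      · exact h
    rcases vert_sub_vert k k' with h | ⟨i, hi⟩ | h
    · exact h.symm
    · rw [hi] at e2
      rcases mul_eq_zero.1 e2 with h | h
      · exact absurd h (by exact_mod_cast ratio_pos.ne')
      · exact absurd h (om_ne_zero i)
    · rw [e2, norm_zero] at h
      linarith [ratio_pos]
  · right
    rw [hj, vertexVector_eq, vertexVector_eq, ← mul_sub] at e
    exact eq_add_of_vert_sub_vert (mul_left_cancel₀ hrc e).symm
  · exfalso
    have h4 := norm_sub_le (vertexVector n k') (vertexVector n k)
    rw [← e] at h4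
    linarith [norm_vertexVector_lt n k, norm_vertexVector_lt n k']

/-- Edge-sharing dodecagons are separated by the line through the common edge, other distinct ones
by distance. -/
theorem eq_of_mem_openPiece_of_mem_dodecagon {n : ℕ} {x x' z : ℂ} {k : Fin 12}
    (hx : x ∈ centres n) (hx' : x' ∈ centres n) (hz : z ∈ openPiece n x k)
    (hz' : z ∈ dodecagon n x') : x = x' := by
  have hr := ratio_pow_pos n
  rcases centres_separated n hx hx' with h | ⟨j, hj⟩ | h
  · exact h
  · exfalso
    have h1 := comp_lt_of_mem_openPiece hz j
    have h2 := comp_le_of_mem_dodecagon hz' (j + 6)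
    rw [comp_add_six, show z - x' = (z - x) - (x' - x) by ring, hj, comp_sub, comp_smul,
      comp_om_self] at h2
    linarith
  · exfalso
    have h1 := norm_sub_le_of_mem_dodecagon (openPiece_subset_dodecagon n x k hz)
    have h2 := norm_sub_le_of_mem_dodecagon hz'
    have h3 := norm_sub_le (z - x) (z - x')
    rw [show z - x - (z - x') = x' - x by ring] at h3
    linarith

/-- The union of the dodecagons of generation `n`. -/
def packing (n : ℕ) : Set ℂ := ⋃ v ∈ centres n, dodecagon n v

theorem mem_packing {n : ℕ} {z : ℂ} : z ∈ packing n ↔ ∃ v ∈ centres n, z ∈ dodecagon n v := by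
  simp [packing]

theorem mem_dodecagon_iff_sub {n : ℕ} {x z : ℂ} : z ∈ dodecagon n x ↔ z - x ∈ dodecagon n 0 := by
  simp [mem_dodecagon_iff]

theorem isClosed_packing (n : ℕ) : IsClosed (packing n) := by
  have : packing n = centres n + dodecagon n 0 := by
    ext z
    rw [mem_packing, Set.mem_add]
    constructor
    · rintro ⟨v, hv, hz⟩
      exact ⟨v, hv, z - v, mem_dodecagon_iff_sub.1 hz, by ring⟩
    · rintro ⟨v, hv, u, hu, rfl⟩
      exact ⟨v, hv, mem_dodecagon_iff_sub.2 (by simpa using hu)⟩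
  rw [this]
  exact (isClosed_centres n).add_right_of_isCompact (isCompact_dodecagon n 0)

theorem centres_add {n : ℕ} {x g : ℂ} (hx : x ∈ centres n) (hg : g ∈ hexagonalLattice) :
    x + g ∈ centres n := by
  induction n generalizing x with
  | zero => exact add_mem (S := AddSubgroup ℂ) hx hg
  | succ n ih =>
    obtain ⟨y, hy, k, rfl⟩ := hx
    exact ⟨y + g, ih hy, k, by ring⟩

theorem centres_sub {n : ℕ} {x g : ℂ} (hx : x ∈ centres n) (hg : g ∈ hexagonalLattice) :
    x - g ∈ centres n := by
  rw [sub_eq_add_neg]; exact centres_add hx (neg_mem hg)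

/-- `IsDescendant m y n x` says that `x` is reached from the centre `y` of generation `m` by
passing to vertices up to generation `n`. -/
inductive IsDescendant (m : ℕ) (y : ℂ) : ℕ → ℂ → Prop
  | refl : IsDescendant m y m y
  | step {n : ℕ} {x : ℂ} (h : IsDescendant m y n x) (k : Fin 12) :
      IsDescendant m y (n + 1) (x + vertexVector n k)

theorem IsDescendant.mem_centres {m n : ℕ} {y x : ℂ} (h : IsDescendant m y n x)
    (hy : y ∈ centres m) : x ∈ centres n := by
  induction h with
  | refl => exact hy
  | step _ k ih => exact ⟨_, ih, k, rfl⟩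

theorem IsDescendant.trans {l m n : ℕ} {x y z : ℂ} (h : IsDescendant l z m y)
    (h' : IsDescendant m y n x) : IsDescendant l z n x := by
  induction h' with
  | refl => exact h
  | step _ k ih => exact ih.step k

/-- The displacements form a geometric series, and `0.5177 / (1 - 0.268) < 3 / 4`. -/
theorem IsDescendant.norm_sub_le {m n : ℕ} {y x : ℂ} (h : IsDescendant m y n x) :
    ‖x - y‖ ≤ 3 / 4 * (ratio ^ m - ratio ^ n) := by
  induction h with
  | refl => simp
  | @step n x _ k ih =>
    have h1 := norm_add_le (x - y) (vertexVector n k)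
    rw [show x - y + vertexVector n k = x + vertexVector n k - y by ring] at h1
    have h2 := norm_vertexVector_lt n k
    have h3 := mul_lt_mul_of_pos_right ratio_lt (ratio_pow_pos n)
    rw [pow_succ']
    linarith [ratio_pow_pos n]

theorem IsDescendant.norm_sub_le_of_mem {m n : ℕ} {y x z : ℂ} (h : IsDescendant m y n x)
    (hz : z ∈ dodecagon n x) : ‖z - y‖ ≤ 3 / 4 * ratio ^ m := by
  have h1 := h.norm_sub_le
  have h2 := norm_sub_le_of_mem_dodecagon hz
  have h3 := norm_add_le (z - x) (x - y)
  rw [sub_add_sub_cancel] at h3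
  linarith [ratio_pow_pos n]

theorem exists_isDescendant {m n : ℕ} (hmn : m ≤ n) {x : ℂ} (hx : x ∈ centres n) :
    ∃ y ∈ centres m, IsDescendant m y n x := by
  induction n, hmn using Nat.le_induction generalizing x with
  | base => exact ⟨x, hx, .refl⟩
  | succ n _ ih =>
    obtain ⟨v, hv, k, rfl⟩ := hx
    obtain ⟨y, hy, h⟩ := ih hv
    exact ⟨y, hy, h.step k⟩

/-- The factor `4 / 5` is meant to beat the radius `3 / 4` within which all dodecagons descending
from `w` stay. -/
theorem le_norm_sub_of_not_vertex {m : ℕ} {y w z : ℂ} (hy : y ∈ centres m)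
    (hw : w ∈ centres (m + 1)) (hne : ∀ k, w ≠ y + vertexVector m k) (hz : z ∈ dodecagon m y) :
    4 / 5 * ratio ^ (m + 1) ≤ ‖w - z‖ := by
  have hr := ratio_pow_pos m
  obtain ⟨y', hy', k, rfl⟩ := hw
  rcases centres_separated m hy hy' with rfl | ⟨j, hj⟩ | h
  · exact absurd rfl (hne k)
  · have e : y' + vertexVector m k = y + (ratio ^ m : ℝ) * (om j + vert k) := by
      rw [vertexVector_eq, show y' = y + (y' - y) by ring, hj]; ring
    rcases separated_vert j k with ⟨l, hl⟩ | ⟨i, hi⟩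
    · exact absurd (by rw [e, hl, vertexVector_eq]) (hne l)
    · refine le_trans ?_ (comp_le_norm i _)
      have h1 := comp_le_of_mem_dodecagon hz i
      rw [e, show y + (ratio ^ m : ℝ) * (om j + vert k) - z =
        (ratio ^ m : ℝ) * (om j + vert k) - (z - y) by ring, comp_sub, comp_smul, pow_succ]
      nlinarith
  · have h1 := norm_sub_le_of_mem_dodecagon hz
    have h2 := norm_vertexVector_lt m k
    have h3 := norm_add_le (y' + vertexVector m k - z) (z - y - vertexVector m k)
    have h4 := norm_sub_le (z - y) (vertexVector m k)
    rw [show y' + vertexVector m k - z + (z - y - vertexVector m k) = y' - y by ring] at h3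
    have h5 := mul_lt_mul_of_pos_right ratio_lt hr
    rw [pow_succ]
    linarith

/-- Dodecagons of different generations meet only by descent: the ancestor of generation `m + 1`
must be a vertex of the larger dodecagon, as otherwise its whole offspring stays away from it. -/
theorem isDescendant_of_mem {m n : ℕ} (hmn : m < n) {x y z : ℂ} (hy : y ∈ centres m)
    (hx : x ∈ centres n) (hzy : z ∈ dodecagon m y) (hzx : z ∈ dodecagon n x) :
    ∃ k, IsDescendant (m + 1) (y + vertexVector m k) n x := by
  obtain ⟨w, hw, h⟩ := exists_isDescendant (show m + 1 ≤ n from hmn) hx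
  by_cases hne : ∃ k, w = y + vertexVector m k
  · obtain ⟨k, rfl⟩ := hne
    exact ⟨k, h⟩
  · push Not at hne
    have h1 := le_norm_sub_of_not_vertex hy hw hne hzy
    have h2 := h.norm_sub_le_of_mem hzx
    rw [norm_sub_rev] at h1
    linarith [ratio_pow_pos (m + 1)]

theorem IsDescendant.of_vertex {m n : ℕ} {x y : ℂ} {k : Fin 12}
    (h : IsDescendant (m + 1) (y + vertexVector m k) n x) : IsDescendant m y n x :=
  (IsDescendant.refl.step k).trans h

/-- A vertex either belongs to two dodecagons, or lies deep inside a dodecagon of an earlier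
generation. -/
theorem exists_link_or_subset (n : ℕ) : ∀ {x : ℂ} (k : Fin 12), x ∈ centres n →
    (∃ x' ∈ centres n, ∃ k' : Fin 12, (k' = k + 5 ∨ k' = k + 7) ∧
      x + vertexVector n k = x' + vertexVector n k') ∨
    ∃ m ≤ n, ∃ y ∈ centres m,
      Metric.closedBall (x + vertexVector n k) (3 / 4 * ratio ^ (n + 1)) ⊆ dodecagon m y := by
  induction n with
  | zero =>
    intro x k hx
    left
    -- Lattice neighbours lie in the even directions. Of the edges `k` and `k + 1` at vertex `k`,
    -- the one with even index is shared.
    rcases Nat.even_or_odd (k : ℕ) with hk | hk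
    · refine ⟨x + om k, add_mem (S := AddSubgroup ℂ) hx (om_even_mem k hk), k + 5, Or.inl rfl, ?_⟩
      rw [vertexVector_eq, vertexVector_eq, ← vert_add_five]
      push_cast; ring
    · refine ⟨x + om (k + 1), add_mem (S := AddSubgroup ℂ) hx (om_even_mem _ ?_), k + 7,
        Or.inr rfl, ?_⟩
      · clear hx; revert hk; decide +revert
      · rw [vertexVector_eq, vertexVector_eq, ← vert_add_seven]
        push_cast; ring
  | succ n ih =>
    intro x k hx
    -- Seen from a parent `v` having `x` as vertex `i`: the three most inward vertices lie deep
    -- inside the parent, and the next two on each side are shared with the dodecagons at adjacent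
    -- vertices of the parent.
    have key : ∀ (v : ℂ) (i : Fin 12), v ∈ centres n → x = v + vertexVector n i →
        (k = i + 5 ∨ k = i + 6 ∨ k = i + 7) ∨
        (k = i + 3 ∨ k = i + 4 ∨ k = i + 8 ∨ k = i + 9) →
        (∃ x' ∈ centres (n + 1), ∃ k' : Fin 12, (k' = k + 5 ∨ k' = k + 7) ∧
          x + vertexVector (n + 1) k = x' + vertexVector (n + 1) k') ∨
        ∃ m ≤ n + 1, ∃ y ∈ centres m,
          Metric.closedBall (x + vertexVector (n + 1) k) (3 / 4 * ratio ^ (n + 1 + 1)) ⊆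
            dodecagon m y := by
      rintro v i hv rfl (h | h)
      · right
        refine ⟨n, by omega, v, hv, fun z hz => mem_dodecagon_iff.2 fun j => ?_⟩
        rw [mem_closedBall_iff_norm] at hz
        have h1 := inner_vert h j
        have h2 := comp_le_norm j (z - (v + vertexVector n i + vertexVector (n + 1) k))
        have e : z - v = (z - (v + vertexVector n i + vertexVector (n + 1) k)) +
            (ratio ^ n : ℝ) * (vert i + ratio * vert k) := by
          rw [vertexVector_eq, vertexVector_eq]; push_cast; ring
        rw [e, comp_add, comp_smul]
        have h3 := mul_le_mul_of_nonneg_left h1 (ratio_pow_pos n).le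
        have h4 : ratio ^ (n + 1 + 1) = ratio ^ n * ratio ^ 2 := by ring
        rw [h4] at hz
        linarith
      · left
        have sib : ∀ (i' : Fin 12) (l : Fin 12), vert i' - vert i = ratio * om l →
            (k = l ∨ k + 1 = l) → ∃ x' ∈ centres (n + 1), ∃ k' : Fin 12, (k' = k + 5 ∨ k' = k + 7) ∧
              v + vertexVector n i + vertexVector (n + 1) k = x' + vertexVector (n + 1) k' := by
          intro i' l hl hkl
          have e : vertexVector n i' = vertexVector n i + (ratio ^ (n + 1) : ℝ) * om l := by
            rw [vertexVector_eq, vertexVector_eq]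
            push_cast
            linear_combination (ratio ^ n : ℂ) * hl
          rcases hkl with rfl | rfl
          · refine ⟨_, ⟨v, hv, i', rfl⟩, k + 5, Or.inl rfl, ?_⟩
            rw [e, vertexVector_eq (n + 1), vertexVector_eq (n + 1), ← vert_add_five]; ring
          · refine ⟨_, ⟨v, hv, i', rfl⟩, k + 7, Or.inr rfl, ?_⟩
            rw [e, vertexVector_eq (n + 1), vertexVector_eq (n + 1), ← vert_add_seven]; ring
        rcases h with rfl | rfl | rfl | rfl
        · exact sib _ _ (vert_succ i) (Or.inr (by clear * -; decide +revert))
        · exact sib _ _ (vert_succ i) (Or.inl rfl)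
        · exact sib _ _ (vert_pred i) (Or.inr (by clear * -; decide +revert))
        · exact sib _ _ (vert_pred i) (Or.inl rfl)
    obtain ⟨v, hv, i, rfl⟩ := hx
    rcases ih i hv with ⟨v', hv', i', hi', he⟩ | ⟨m, hm, y, hy, hsub⟩
    -- The five outward directions at one parent are covered by the seven inward or sideways
    -- directions at the second parent.
    · have hcase : ((k = i + 5 ∨ k = i + 6 ∨ k = i + 7) ∨
          (k = i + 3 ∨ k = i + 4 ∨ k = i + 8 ∨ k = i + 9)) ∨
          ((k = i' + 5 ∨ k = i' + 6 ∨ k = i' + 7) ∨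
          (k = i' + 3 ∨ k = i' + 4 ∨ k = i' + 8 ∨ k = i' + 9)) := by
        clear * - hi'
        revert hi'; revert i i' k; decide +kernel
      rcases hcase with h | h
      · exact key v i hv rfl h
      · exact key v' i' hv' he h
    -- If `x` itself is deep inside an earlier dodecagon, so are its vertices: `0.5177 + 3 / 4 *
    -- ratio < 3 / 4`.
    · right
      refine ⟨m, by omega, y, hy, subset_trans (Metric.closedBall_subset_closedBall' ?_) hsub⟩
      rw [dist_eq_norm, add_sub_cancel_left]
      have h1 := norm_vertexVector_lt (n + 1) k
      have h2 := mul_lt_mul_of_pos_right ratio_lt (ratio_pow_pos (n + 1))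
      rw [pow_succ' ratio (n + 1)]
      linarith [ratio_pow_pos (n + 1)]

/-! ### The colouring -/

/-- The points `w + ε d` with small `ε > 0` lie in the interior of `F`. -/
def Germ (F : Set ℂ) (w d : ℂ) : Prop :=
  ∀ᶠ ε : ℝ in nhdsWithin 0 (Set.Ioi 0), w + ε * d ∈ interior F

open Classical in
/-- The colour whose even pieces are red if `e` and whose odd pieces are red if `o`. -/
def mkColour (e o : Prop) : Colour :=
  if e then (if o then .red else .evenRed) else (if o then .oddRed else .white)

/-- The `k`-th piece is red. -/
def Colour.IsRed : Colour → Fin 12 → Prop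
  | .white, _ => False
  | .red, _ => True
  | .evenRed, k => Even (k : ℕ)
  | .oddRed, k => Odd (k : ℕ)

theorem mem_redPart {n : ℕ} {x z : ℂ} {c : Colour} :
    z ∈ redPart n x c ↔ ∃ k, c.IsRed k ∧ z ∈ piece n x k := by
  cases c with
  | white => simp [redPart, Colour.IsRed]
  | red =>
    simp only [redPart, Colour.IsRed, true_and]
    exact ⟨exists_mem_piece, fun ⟨k, hk⟩ => piece_subset_dodecagon n x k hk⟩
  | evenRed => simp [redPart, Colour.IsRed]
  | oddRed => simp [redPart, Colour.IsRed]

/-- The direction at a vertex with index `k` that decides upon the colour of the pieces with the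
parity of `j`. -/
def linkDir (n : ℕ) (k j : Fin 12) : ℂ :=
  if Even (j : ℕ) ↔ Even (k : ℕ) then -vertexVector n k else vertexVector n k

theorem isRed_mkColour {n : ℕ} (F : Set ℂ) (w : ℂ) (k j : Fin 12) :
    (mkColour (Germ F w (linkDir n k 0)) (Germ F w (linkDir n k 1))).IsRed j ↔
      Germ F w (linkDir n k j) := by
  have h : linkDir n k j = if Even (j : ℕ) then linkDir n k 0 else linkDir n k 1 := by
    unfold linkDir
    by_cases hj : Even (j : ℕ) <;> simp [hj]
  rw [h]
  unfold mkColour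
  by_cases hj : Even (j : ℕ)
  · rw [if_pos hj]
    split_ifs <;> simp_all [Colour.IsRed]
  · rw [if_neg hj]
    split_ifs <;> simp_all [Colour.IsRed]

open Classical in
/-- The colour of the dodecagon of generation `n + 1` with centre `w`, when `F` is the iterate
of generation `n`. -/
def newColour (n : ℕ) (F : Set ℂ) (w : ℂ) : Colour :=
  if h : ∃ k, w - vertexVector n k ∈ centres n then
    mkColour (Germ F w (linkDir n h.choose 0)) (Germ F w (linkDir n h.choose 1))
  else .white

/-- The iterates of the colouring. -/
def cells : ℕ → Set ℂ
  | 0 => dodecagon 0 0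
  | n + 1 => closure ((cells n \ ⋃ v ∈ centres (n + 1), dodecagon (n + 1) v) ∪
      ⋃ v ∈ centres (n + 1), redPart (n + 1) v (newColour n (cells n) v))

/-- The colouring. -/
def colouring : ℕ → ℂ → Colour
  | 0, _ => .white
  | n + 1, v => newColour n (cells n) v

theorem iterate_colouring (n : ℕ) : iterate colouring n = cells n := by
  induction n with
  | zero => rfl
  | succ n ih => simp only [iterate, cells, ih, colouring]

/-- The `k`-th piece of the dodecagon of generation `n` with centre `x` is red. -/
def Red : ℕ → ℂ → Fin 12 → Prop
  | 0, x, _ => x = 0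
  | n + 1, x, k => (newColour n (cells n) x).IsRed k

theorem mem_cells_succ {n : ℕ} {z : ℂ} : z ∈ cells (n + 1) ↔
    z ∈ closure ((cells n \ packing (n + 1)) ∪
      {z | ∃ v ∈ centres (n + 1), ∃ k, Red (n + 1) v k ∧ z ∈ piece (n + 1) v k}) := by
  have : (⋃ v ∈ centres (n + 1), redPart (n + 1) v (newColour n (cells n) v)) =
      {z | ∃ v ∈ centres (n + 1), ∃ k, Red (n + 1) v k ∧ z ∈ piece (n + 1) v k} := by
    ext z; simp [mem_redPart, Red]
  rw [← this]; rfl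

theorem isClosed_cells (n : ℕ) : IsClosed (cells n) := by
  cases n with
  | zero => exact isClosed_dodecagon _ _
  | succ n => exact isClosed_closure

theorem piece_subset_cells {n : ℕ} {x : ℂ} {k : Fin 12} (hx : x ∈ centres n) (h : Red n x k) :
    piece n x k ⊆ cells n := by
  cases n with
  | zero =>
    have : x = 0 := h
    subst this
    exact piece_subset_dodecagon _ _ _
  | succ n =>
    intro z hz
    exact mem_cells_succ.2 (subset_closure (Or.inr ⟨x, hx, k, h, hz⟩))

theorem Germ.mem {F : Set ℂ} (hF : IsClosed F) {w d : ℂ} (h : Germ F w d) :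
    w ∈ F := by
  have ht : Filter.Tendsto (fun ε : ℝ => w + ε * d) (nhdsWithin 0 (Set.Ioi 0)) (nhds w) := by
    have : Continuous fun ε : ℝ => w + ε * d := by fun_prop
    have h2 := (this.tendsto 0).mono_left (nhdsWithin_le_nhds (s := Set.Ioi 0))
    simpa using h2
  exact hF.mem_of_tendsto ht (h.mono fun ε hε => interior_subset hε)

theorem germ_of_mem_interior {F : Set ℂ} {w : ℂ} (h : w ∈ interior F) (d : ℂ) : Germ F w d := by
  have ht : Filter.Tendsto (fun ε : ℝ => w + ε * d) (nhdsWithin 0 (Set.Ioi 0)) (nhds w) := by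
    have : Continuous fun ε : ℝ => w + ε * d := by fun_prop
    have h2 := (this.tendsto 0).mono_left (nhdsWithin_le_nhds (s := Set.Ioi 0))
    simpa using h2
  exact ht.eventually (isOpen_interior.mem_nhds h)

theorem exists_link {n : ℕ} {w : ℂ} (hw : w ∈ centres (n + 1)) :
    ∃ k, w - vertexVector n k ∈ centres n := by
  obtain ⟨x, hx, k, rfl⟩ := hw
  exact ⟨k, by simpa using hx⟩

/-- No germ starts outside the closed set `cells n`, and every germ starting in its interior is
present. -/
theorem isRefinement_colouring : IsRefinement colouring := by
  intro n v hv
  rw [iterate_colouring]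
  have hl := exists_link hv
  simp only [colouring, newColour, dif_pos hl]
  constructor
  · intro h
    have : ∀ d, ¬ Germ (cells n) v d := fun d hd => h (hd.mem (isClosed_cells n))
    simp [mkColour, this]
  · intro h
    simp [mkColour, germ_of_mem_interior h]

theorem mem_cells_of_red {n : ℕ} {w : ℂ} {k : Fin 12} (h : Red (n + 1) w k) : w ∈ cells n := by
  simp only [Red, newColour] at h
  split_ifs at h with hl
  · rw [isRed_mkColour] at h
    exact h.mem (isClosed_cells n)
  · exact h.elim

theorem not_mem_cells {n : ℕ} {x z : ℂ} {k : Fin 12} (hx : x ∈ centres n) (h : ¬ Red n x k)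
    (hz : z ∈ openPiece n x k) : z ∉ cells n := by
  cases n with
  | zero =>
    intro hz'
    exact h (eq_of_mem_openPiece_of_mem_dodecagon hx (zero_mem hexagonalLattice) hz hz')
  | succ n =>
    intro hz'
    rw [mem_cells_succ, mem_closure_iff] at hz'
    obtain ⟨y, hy, hy'⟩ := hz' _ (isOpen_openPiece _ x k) hz
    rcases hy' with ⟨-, hy'⟩ | ⟨v, hv, j, hj, hy'⟩
    · exact hy' (mem_packing.2 ⟨x, hx, openPiece_subset_dodecagon _ _ _ hy⟩)
    · obtain rfl := eq_of_mem_openPiece_of_mem_dodecagon hx hv hy (piece_subset_dodecagon _ _ _ hy')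
      obtain rfl := eq_of_mem_openPiece_of_mem_piece hy hy'
      exact h hj

theorem mem_cells_succ_iff {n : ℕ} {z : ℂ} (hz : z ∉ packing (n + 1)) :
    z ∈ cells (n + 1) ↔ z ∈ cells n := by
  rw [mem_cells_succ]
  constructor
  · intro h
    rw [← (isClosed_cells n).closure_eq, mem_closure_iff]
    intro o ho hzo
    rw [mem_closure_iff] at h
    obtain ⟨y, ⟨hy, hy2⟩, hy'⟩ := h _ (ho.inter (isClosed_packing (n + 1)).isOpen_compl) ⟨hzo, hz⟩
    rcases hy' with ⟨h1, -⟩ | ⟨v, hv, k, -, h3⟩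
    · exact ⟨y, hy, h1⟩
    · exact absurd (mem_packing.2 ⟨v, hv, piece_subset_dodecagon _ _ _ h3⟩) hy2
  · intro h
    exact subset_closure (Or.inl ⟨h, hz⟩)

/-- Vertex `k` is a corner of piece `k` with angle `5π / 6`, bisected by direction `k + 6`;
directions `k + 5` and `k + 7` deviate from the bisector by only `π / 6`. -/
theorem eventually_mem_openPiece (n : ℕ) (x : ℂ) (k l : Fin 12)
    (hl : l = k + 5 ∨ l = k + 6 ∨ l = k + 7) :
    ∀ᶠ ε : ℝ in nhdsWithin 0 (Set.Ioi 0),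
      x + vertexVector n k + ε * vertexVector n l ∈ openPiece n x k := by
  have hr := ratio_pow_pos n
  have h1 := sqrt_three_gt
  filter_upwards [Ioo_mem_nhdsGT ratio_pos] with ε hε
  have e : x + vertexVector n k + ε * vertexVector n l - x =
      (ratio ^ n : ℝ) * (vert k + ε * vert l) := by
    rw [vertexVector_eq, vertexVector_eq]; ring
  have hdiv : ratio ^ n / 2 = ratio ^ n * (1 / 2) := by ring
  simp only [openPiece, Set.mem_ofPred_eq, e, comp_smul, comp_add, hdiv]
  have h3 : comp (k + 3) (vert k) = ratio / 2 := by
    rw [comp_vert, comp_zero_vert_cases, show k - (k + 3) = 9 by clear * -; decide +revert]; simp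
  have h4 : comp (k + 4) (vert k) = - ratio / 2 := by
    rw [comp_vert, comp_zero_vert_cases, show k - (k + 4) = 8 by clear * -; decide +revert]; simp
  have h5 := comp_vert_le (k + 3 + 6) l
  have h6 := comp_vert_le (k + 4) l
  rw [comp_add_six] at h5
  have h7 : comp k (vert l) < 0 := by
    have : l - k = 5 ∨ l - k = 6 ∨ l - k = 7 := by
      rcases hl with rfl | rfl | rfl <;> simp
    rw [comp_vert, comp_zero_vert_cases]
    rcases this with h | h | h <;> rw [h] <;> simp <;> linarith
  have h8 : comp (k + 1) (vert l) < 0 := by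
    have : l - (k + 1) = 4 ∨ l - (k + 1) = 5 ∨ l - (k + 1) = 6 := by
      clear * - hl; revert hl; decide +revert
    rw [comp_vert, comp_zero_vert_cases]
    rcases this with h | h | h <;> rw [h] <;> simp <;> linarith
  have h9 := comp_vert_le k k
  have h10 := comp_vert_le (k + 1) k
  have hε1 := hε.1
  have hε2 := hε.2
  rw [h3, h4]
  refine ⟨mul_pos hr ?_, mul_neg_of_pos_of_neg hr ?_, mul_lt_mul_of_pos_left ?_ hr,
    mul_lt_mul_of_pos_left ?_ hr⟩ <;> nlinarith

/-- The germ runs inside an open piece, which is contained in `cells n` if red and disjoint from it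
otherwise. -/
theorem germ_iff_red {n : ℕ} {x : ℂ} {k l : Fin 12} (hx : x ∈ centres n)
    (hl : l = k + 5 ∨ l = k + 6 ∨ l = k + 7) :
    Germ (cells n) (x + vertexVector n k) (vertexVector n l) ↔ Red n x k := by
  have he := eventually_mem_openPiece n x k l hl
  constructor
  · intro h
    by_contra hr
    obtain ⟨ε, h1, h2⟩ := (he.and h).exists
    exact not_mem_cells hx hr h1 (interior_subset h2)
  · intro h
    refine he.mono fun ε hε => ?_
    exact interior_maximal ((openPiece_subset_piece _ _ _).trans (piece_subset_cells hx h))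
      (isOpen_openPiece _ _ _) hε

theorem vertexVector_add_six (n : ℕ) (k : Fin 12) : vertexVector n (k + 6) = -vertexVector n k := by
  rw [vertexVector_eq, vertexVector_eq, vert_add_six]; ring

/-- The colour of a dodecagon may be read off at any of the dodecagons it is a vertex of. -/
theorem red_succ_iff {n : ℕ} {x : ℂ} {k : Fin 12} (hx : x ∈ centres n) (j : Fin 12) :
    Red (n + 1) (x + vertexVector n k) j ↔
      Germ (cells n) (x + vertexVector n k) (linkDir n k j) := by
  have hl : ∃ l, x + vertexVector n k - vertexVector n l ∈ centres n := ⟨k, by simpa using hx⟩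
  simp only [Red, newColour, dif_pos hl]
  rw [isRed_mkColour]
  have hy := hl.choose_spec
  generalize hl.choose = l at *
  have e : x + vertexVector n k - vertexVector n l + vertexVector n l = x + vertexVector n k := by
    ring
  rcases eq_vertex_of_eq hy hx e with ⟨h, -⟩ | h
  · rw [h]
  -- For pieces with the parity of `a`, the first dodecagon looks inward and the second outward. As
  -- `b = a + 5` or `a + 7`, both directions enter piece `a` of the first.
  · have key : ∀ (y y' : ℂ) (a b : Fin 12), y ∈ centres n → y' ∈ centres n →
        (b = a + 5 ∨ b = a + 7) → y + vertexVector n a = y' + vertexVector n b →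
        (Even (j : ℕ) ↔ Even (a : ℕ)) →
        (Germ (cells n) (y + vertexVector n a) (linkDir n a j) ↔
          Germ (cells n) (y + vertexVector n a) (linkDir n b j)) := by
      intro y y' a b hy hy' hab he hj
      have hb : ¬ (Even (j : ℕ) ↔ Even (b : ℕ)) := by
        rw [hj]; clear * - hab; revert hab; decide +revert
      rw [linkDir, if_pos hj, linkDir, if_neg hb, ← vertexVector_add_six, germ_iff_red hy (by simp),
        germ_iff_red hy (by tauto)]
    have hpar : (Even (j : ℕ) ↔ Even (l : ℕ)) ∨ (Even (j : ℕ) ↔ Even (k : ℕ)) := by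
      clear * - h; revert h; decide +revert
    rcases hpar with hj | hj
    · have := key _ _ l k hy hx h e hj
      rwa [e] at this
    · exact (key _ _ k l hx hy (by clear * - h; revert h; decide +revert) e.symm hj).symm

/-! ### Disjointness of the translates -/

theorem openPiece_sub {n : ℕ} {x z : ℂ} {k : Fin 12} (g : ℂ) :
    z - g ∈ openPiece n (x - g) k ↔ z ∈ openPiece n x k := by
  simp [openPiece]

theorem packing_sub {n : ℕ} {z g : ℂ} (hg : g ∈ hexagonalLattice) :
    z - g ∈ packing n ↔ z ∈ packing n := by
  rw [mem_packing, mem_packing]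
  constructor
  · rintro ⟨v, hv, h⟩
    refine ⟨v + g, centres_add hv hg, ?_⟩
    rw [mem_dodecagon_iff] at h ⊢
    simpa [sub_sub, add_comm] using h
  · rintro ⟨v, hv, h⟩
    refine ⟨v - g, centres_sub hv hg, ?_⟩
    rw [mem_dodecagon_iff] at h ⊢
    simpa using h

theorem exists_openPiece_of_isOpen {n : ℕ} {W : Set ℂ} (hW : IsOpen W) {z : ℂ} (hz : z ∈ W)
    (h : z ∈ packing n) : ∃ x ∈ centres n, ∃ k, (W ∩ openPiece n x k).Nonempty := by
  obtain ⟨x, hx, hzx⟩ := mem_packing.1 h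
  obtain ⟨k, hk⟩ := exists_mem_piece hzx
  exact ⟨x, hx, k, mem_closure_iff.1 (piece_subset_closure_openPiece n x k hk) W hW hz⟩

/-- An overlap either misses the newest packing, and then existed before, or contains points of a
piece red at both `w` and `w - g`; the germs behind these colours give an earlier overlap. -/
theorem not_mem_interior_cells_sub (n : ℕ) {g : ℂ} (hg : g ∈ hexagonalLattice) (h0 : g ≠ 0) :
    ∀ {z : ℂ}, z ∈ interior (cells n) → z - g ∉ interior (cells n) := by
  have hopen : ∀ n, IsOpen (interior (cells n) ∩ (fun z => z - g) ⁻¹' interior (cells n)) :=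
    fun n => isOpen_interior.inter (isOpen_interior.preimage (continuous_sub_right g))
  induction n with
  | zero =>
    intro z hz hz'
    obtain ⟨k, hk⟩ := exists_mem_piece (interior_subset hz)
    obtain ⟨y, ⟨hy1, hy2⟩, hy3⟩ :=
      mem_closure_iff.1 (piece_subset_closure_openPiece _ _ k hk) _ (hopen 0) ⟨hz, hz'⟩
    have hy4 : y ∈ dodecagon 0 g := mem_dodecagon_iff_sub.2 (interior_subset hy2)
    exact h0 (eq_of_mem_openPiece_of_mem_dodecagon (n := 0) (zero_mem hexagonalLattice) hg hy3
      hy4).symm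
  | succ n ih =>
    intro z hz hz'
    by_cases hp : ∃ y ∈ interior (cells (n + 1)) ∩ (fun z => z - g) ⁻¹' interior (cells (n + 1)),
        y ∈ packing (n + 1)
    · obtain ⟨y, hy, hyp⟩ := hp
      obtain ⟨w, hw, j, u, ⟨hu1, hu2⟩, hu3⟩ := exists_openPiece_of_isOpen (hopen (n + 1)) hy hyp
      have h1 : Red (n + 1) w j := by
        by_contra h
        exact not_mem_cells hw h hu3 (interior_subset hu1)
      have h2 : Red (n + 1) (w - g) j := by
        by_contra h
        exact not_mem_cells (centres_sub hw hg) h ((openPiece_sub g).2 hu3) (interior_subset hu2)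
      obtain ⟨x, hx, k, rfl⟩ := hw
      rw [red_succ_iff hx] at h1
      rw [show x + vertexVector n k - g = x - g + vertexVector n k by ring,
        red_succ_iff (centres_sub hx hg)] at h2
      obtain ⟨ε, h3, h4⟩ := (h1.and h2).exists
      refine ih h3 ?_
      convert h4 using 1
      ring
    · push Not at hp
      have hsub : ∀ y ∈ interior (cells (n + 1)) ∩
          (fun z => z - g) ⁻¹' interior (cells (n + 1)), y ∈ cells n ∧ y - g ∈ cells n := by
        intro y hy
        refine ⟨(mem_cells_succ_iff (hp y hy)).1 (interior_subset hy.1), ?_⟩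
        exact (mem_cells_succ_iff (fun h => hp y hy ((packing_sub hg).1 h))).1
          (interior_subset hy.2)
      refine ih (z := z) (interior_maximal (fun y hy => (hsub y hy).1) (hopen _) ⟨hz, hz'⟩) ?_
      refine mem_interior_iff_mem_nhds.2 ?_
      have hn := (hopen (n + 1)).mem_nhds ⟨hz, hz'⟩
      have ht : Filter.Tendsto (fun y => y + g) (nhds (z - g)) (nhds z) := by
        have := (continuous_add_const g).tendsto (z - g)
        simpa using this
      filter_upwards [ht hn] with y hy
      simpa using (hsub _ hy).2

/-! ### Dihedral symmetry -/

/-- A linear isometry that permutes the vertices and pieces of the dodecagons centred at the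
origin, reversing their parity. -/
structure IsPackingSymmetry (φ : ℂ ≃ₗᵢ[ℝ] ℂ) (σ : Equiv.Perm (Fin 12)) : Prop where
  map_vert : ∀ k, φ (vert k) = vert (σ k)
  mem_piece : ∀ {n : ℕ} {x z : ℂ} {k : Fin 12}, z ∈ piece n x k → φ z ∈ piece n (φ x) (σ k)
  even_iff : ∀ k, Even (σ k : ℕ) ↔ ¬ Even (k : ℕ)

theorem IsPackingSymmetry.map_vertexVector {φ : ℂ ≃ₗᵢ[ℝ] ℂ} {σ : Equiv.Perm (Fin 12)}
    (h : IsPackingSymmetry φ σ) (n : ℕ) (k : Fin 12) :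
    φ (vertexVector n k) = vertexVector n (σ k) := by
  rw [vertexVector_eq, vertexVector_eq, ← h.map_vert, ← Complex.real_smul, map_smul,
    Complex.real_smul]

theorem IsPackingSymmetry.mem_dodecagon {φ : ℂ ≃ₗᵢ[ℝ] ℂ} {σ : Equiv.Perm (Fin 12)}
    (h : IsPackingSymmetry φ σ) {n : ℕ} {x z : ℂ} (hz : z ∈ dodecagon n x) :
    φ z ∈ dodecagon n (φ x) := by
  obtain ⟨k, hk⟩ := exists_mem_piece hz
  exact piece_subset_dodecagon _ _ _ (h.mem_piece hk)

theorem IsPackingSymmetry.isDescendant {φ : ℂ ≃ₗᵢ[ℝ] ℂ} {σ : Equiv.Perm (Fin 12)}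
    (h : IsPackingSymmetry φ σ) {n : ℕ} {x : ℂ} (hx : IsDescendant 0 0 n x) :
    IsDescendant 0 0 n (φ x) := by
  induction hx with
  | refl => rw [map_zero]; exact .refl
  | step _ k ih =>
    rw [map_add, h.map_vertexVector]
    exact ih.step _

theorem zero_mem_centres : (0 : ℂ) ∈ centres 0 := zero_mem hexagonalLattice

/-- A dodecagon acquires red pieces only if its centre lies in the previous cell, hence in a
dodecagon descending from 0, and then it descends from 0 too. Finiteness of each generation keeps
the union closed. -/
theorem cells_subset (n : ℕ) :
    cells n ⊆ ⋃ m ∈ Set.Iic n, ⋃ y ∈ {y | IsDescendant 0 0 m y}, dodecagon m y := by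
  induction n with
  | zero =>
    intro z hz
    simp only [Set.mem_iUnion, exists_prop]
    exact ⟨0, by simp, 0, .refl, hz⟩
  | succ n ih =>
    have hfin : ∀ m, {y | IsDescendant 0 0 m y}.Finite := fun m => by
      refine (finite_centres_inter m
        (Metric.isBounded_closedBall (x := (0 : ℂ)) (r := 1))).subset ?_
      intro y hy
      refine ⟨?_, IsDescendant.mem_centres hy zero_mem_centres⟩
      have := IsDescendant.norm_sub_le hy
      rw [mem_closedBall_iff_norm]
      have h2 := ratio_pow_pos m
      rw [pow_zero] at this
      linarith
    refine closure_minimal ?_ ?_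
    · rintro z (hz | hz)
      · have := ih hz.1
        simp only [Set.mem_iUnion, exists_prop] at this ⊢
        obtain ⟨m, hm, h⟩ := this
        exact ⟨m, le_trans (Set.mem_Iic.1 hm) (Nat.le_succ n), h⟩
      · simp only [Set.mem_iUnion, exists_prop, mem_redPart] at hz
        obtain ⟨w, hw, k, hk, hz⟩ := hz
        have hw' := ih (mem_cells_of_red (n := n) hk)
        simp only [Set.mem_iUnion, exists_prop] at hw' ⊢
        obtain ⟨m, hm, y, hy, h⟩ := hw'
        obtain ⟨l, hl⟩ := isDescendant_of_mem (Nat.lt_succ_of_le hm)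
          (IsDescendant.mem_centres hy zero_mem_centres) hw h (centre_mem_dodecagon _ _)
        exact ⟨n + 1, by simp, w, hy.trans hl.of_vertex, piece_subset_dodecagon _ _ _ hz⟩
    · exact (Set.finite_Iic _).isClosed_biUnion fun m _ =>
        (hfin m).isClosed_biUnion fun y _ => isClosed_dodecagon m y

theorem isDescendant_of_mem_cells {n : ℕ} {w z : ℂ} (hw : w ∈ centres (n + 1)) (hz : z ∈ cells n)
    (hzw : z ∈ dodecagon (n + 1) w) : IsDescendant 0 0 (n + 1) w := by
  have := cells_subset n hz
  simp only [Set.mem_iUnion, exists_prop] at this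
  obtain ⟨m, hm, y, hy, h⟩ := this
  obtain ⟨l, hl⟩ := isDescendant_of_mem (Nat.lt_succ_of_le hm)
    (IsDescendant.mem_centres hy zero_mem_centres) hw h hzw
  exact hy.trans hl.of_vertex

/-- The packings need not be invariant, but every dodecagon meeting the previous cell descends from
0, and such dodecagons are permuted. The inverse is used to pull packing points back. -/
theorem cells_invariant {φ : ℂ ≃ₗᵢ[ℝ] ℂ} {σ : Equiv.Perm (Fin 12)} (h : IsPackingSymmetry φ σ)
    (h' : IsPackingSymmetry φ.symm σ.symm) (n : ℕ) : Set.MapsTo φ (cells n) (cells n) := by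
  have main : ∀ n, Set.MapsTo φ (cells n) (cells n) ∧ Set.MapsTo φ.symm (cells n) (cells n) := by
    intro n
    induction n with
    | zero =>
      have h0 : ∀ {φ : ℂ ≃ₗᵢ[ℝ] ℂ} {σ : Equiv.Perm (Fin 12)}, IsPackingSymmetry φ σ →
          Set.MapsTo φ (cells 0) (cells 0) := fun h z hz => by
        have := h.mem_dodecagon hz
        rwa [map_zero] at this
      exact ⟨h0 h, h0 h'⟩
    | succ n ih =>
      have step : ∀ {φ : ℂ ≃ₗᵢ[ℝ] ℂ} {σ : Equiv.Perm (Fin 12)}, IsPackingSymmetry φ σ →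
          IsPackingSymmetry φ.symm σ.symm → Set.MapsTo φ (cells n) (cells n) →
          Set.MapsTo φ (cells (n + 1)) (cells (n + 1)) := by
        intro φ σ h h' hφ z hz
        rw [mem_cells_succ] at hz ⊢
        refine map_mem_closure φ.continuous hz ?_
        rintro z (⟨hz1, hz2⟩ | ⟨w, hw, j, hj, hz⟩)
        · left
          refine ⟨hφ hz1, fun hp => hz2 ?_⟩
          obtain ⟨w, hw, hzw⟩ := mem_packing.1 hp
          have hd := h'.isDescendant (isDescendant_of_mem_cells hw (hφ hz1) hzw)
          refine mem_packing.2 ⟨_, hd.mem_centres zero_mem_centres, ?_⟩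
          have := h'.mem_dodecagon hzw
          rwa [LinearIsometryEquiv.symm_apply_apply] at this
        · right
          have hd := isDescendant_of_mem_cells hw (mem_cells_of_red hj)
            (centre_mem_dodecagon _ _)
          refine ⟨φ w, (h.isDescendant hd).mem_centres zero_mem_centres, σ j, ?_, h.mem_piece hz⟩
          clear hw
          obtain - | ⟨hx, k⟩ := hd
          rename_i x
          have hx1 := hx.mem_centres zero_mem_centres
          have hx2 := (h.isDescendant hx).mem_centres zero_mem_centres
          rw [red_succ_iff hx1] at hj
          rw [map_add, h.map_vertexVector, red_succ_iff hx2]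
          -- Both parities are reversed, so the comparison that selects inward or outward is
          -- unchanged.
          have hdir : linkDir n (σ k) (σ j) = φ (linkDir n k j) := by
            unfold linkDir
            simp only [h.even_iff, not_iff_not]
            split_ifs
            · rw [map_neg, h.map_vertexVector]
            · rw [h.map_vertexVector]
          rw [hdir]
          refine hj.mono fun ε hε => ?_
          have himg : φ '' interior (cells n) ⊆ interior (cells n) :=
            interior_maximal ((Set.image_mono interior_subset).trans hφ.image_subset)
              (φ.toHomeomorph.isOpenMap _ isOpen_interior)
          have := himg ⟨_, hε, rfl⟩
          rwa [map_add, map_add, h.map_vertexVector, ← Complex.real_smul, map_smul,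
            Complex.real_smul] at this
      exact ⟨step h h' ih.1, step h' (by simpa using h) ih.2⟩
  exact (main n).1

/-! ### Every piece belongs to some translate -/

theorem eventually_lt_or_gt {a b : ℝ} (c : ℝ) (hb : b ≠ 0) :
    (∀ᶠ ε : ℝ in nhdsWithin 0 (Set.Ioi 0), a + ε * b < c) ∨
      ∀ᶠ ε : ℝ in nhdsWithin 0 (Set.Ioi 0), c < a + ε * b := by
  have ht : Filter.Tendsto (fun ε : ℝ => a + ε * b) (nhdsWithin 0 (Set.Ioi 0)) (nhds a) := by
    have : Continuous fun ε : ℝ => a + ε * b := by fun_prop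
    have h2 := (this.tendsto 0).mono_left (nhdsWithin_le_nhds (s := Set.Ioi 0))
    simpa using h2
  rcases lt_trichotomy a c with h | h | h
  · exact Or.inl (ht.eventually_lt_const h)
  · rcases lt_or_gt_of_ne hb with hb | hb
    · left
      filter_upwards [self_mem_nhdsWithin] with ε hε
      nlinarith [Set.mem_Ioi.1 hε]
    · right
      filter_upwards [self_mem_nhdsWithin] with ε hε
      nlinarith [Set.mem_Ioi.1 hε]
  · exact Or.inr (ht.eventually_const_lt h)

theorem comp_vertexVector_ne (n : ℕ) (j k : Fin 12) : comp j (vertexVector n k) ≠ 0 := by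
  rw [vertexVector_eq, comp_smul]
  exact mul_ne_zero (ratio_pow_pos n).ne' (comp_vert_ne j k)

theorem eventually_openPiece_or_not_dodecagon (n m : ℕ) (w y : ℂ) (k : Fin 12) :
    (∃ i, ∀ᶠ ε : ℝ in nhdsWithin 0 (Set.Ioi 0), w + ε * vertexVector n k ∈ openPiece m y i) ∨
      ∀ᶠ ε : ℝ in nhdsWithin 0 (Set.Ioi 0), w + ε * vertexVector n k ∉ dodecagon m y := by
  have e : ∀ (j : Fin 12) (ε : ℝ), comp j (w + ε * vertexVector n k - y) =
      comp j (w - y) + ε * comp j (vertexVector n k) := by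
    intro j ε
    rw [← comp_smul, ← comp_add]; congr 1; ring
  have hdich : ∀ (j : Fin 12) (c : ℝ),
      (∀ᶠ ε : ℝ in nhdsWithin 0 (Set.Ioi 0), comp j (w + ε * vertexVector n k - y) < c) ∨
      ∀ᶠ ε : ℝ in nhdsWithin 0 (Set.Ioi 0), c < comp j (w + ε * vertexVector n k - y) := by
    intro j c
    simp only [e]
    exact eventually_lt_or_gt c (comp_vertexVector_ne n j k)
  by_cases hall : ∀ j, ∀ᶠ ε : ℝ in nhdsWithin 0 (Set.Ioi 0),
      comp j (w + ε * vertexVector n k - y) < ratio ^ m / 2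
  · left
    -- The sign of each component is constant for small `ε`, so the cone found for one `ε` serves
    -- for all small ones.
    set P : Fin 12 → Prop := fun j =>
      ∀ᶠ ε : ℝ in nhdsWithin 0 (Set.Ioi 0), 0 < comp j (w + ε * vertexVector n k - y) with hP
    have h1 : ∀ᶠ ε : ℝ in nhdsWithin 0 (Set.Ioi 0), ∀ j,
        comp j (w + ε * vertexVector n k - y) < ratio ^ m / 2 ∧
        (P j → 0 < comp j (w + ε * vertexVector n k - y)) ∧
        (¬ P j → comp j (w + ε * vertexVector n k - y) < 0) := by
      rw [Filter.eventually_all]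
      intro j
      refine (hall j).and ?_
      by_cases hj : P j
      · exact hj.mono fun ε h => ⟨fun _ => h, fun h' => absurd hj h'⟩
      · rcases hdich j 0 with h | h
        · exact h.mono fun ε h => ⟨fun h' => absurd h' hj, fun _ => h⟩
        · exact absurd h hj
    obtain ⟨ε, hε⟩ := h1.exists
    obtain ⟨i, h3, h4⟩ := exists_cone (w + ε * vertexVector n k - y)
    have hi3 : P (i + 3) := by
      by_contra h
      exact absurd ((hε _).2.2 h) (not_lt.2 h3)
    have hi4 : ¬ P (i + 4) := fun h => absurd ((hε _).2.1 h) (not_lt.2 h4)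
    exact ⟨i, h1.mono fun δ hδ =>
      ⟨(hδ _).2.1 hi3, (hδ _).2.2 hi4, (hδ _).1, (hδ _).1⟩⟩
  · right
    obtain ⟨j, hj⟩ := not_forall.1 hall
    rcases hdich j (ratio ^ m / 2) with h | h
    · exact absurd h hj
    · exact h.mono fun ε hε hd => absurd (comp_le_of_mem_dodecagon hd j) (not_le.2 hε)

theorem ratio_pow_le_one (n : ℕ) : ratio ^ n ≤ 1 :=
  pow_le_one₀ ratio_pos.le (by linarith [ratio_lt])

theorem eventually_openPiece_or_not_packing (n m : ℕ) (w : ℂ) (k : Fin 12) :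
    (∃ y ∈ centres m, ∃ i, ∀ᶠ ε : ℝ in nhdsWithin 0 (Set.Ioi 0),
      w + ε * vertexVector n k ∈ openPiece m y i) ∨
      ∀ᶠ ε : ℝ in nhdsWithin 0 (Set.Ioi 0), w + ε * vertexVector n k ∉ packing m := by
  by_cases h : ∃ y ∈ centres m, ∃ i, ∀ᶠ ε : ℝ in nhdsWithin 0 (Set.Ioi 0),
      w + ε * vertexVector n k ∈ openPiece m y i
  · exact Or.inl h
  · right
    have hfin := finite_centres_inter m (Metric.isBounded_closedBall (x := w) (r := 2))
    have h1 : ∀ᶠ ε : ℝ in nhdsWithin 0 (Set.Ioi 0), ∀ y ∈ Metric.closedBall w 2 ∩ centres m,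
        w + ε * vertexVector n k ∉ dodecagon m y := by
      rw [Filter.eventually_all_finite hfin]
      intro y hy
      rcases eventually_openPiece_or_not_dodecagon n m w y k with h' | h'
      · exact absurd ⟨y, hy.2, h'⟩ h
      · exact h'
    filter_upwards [h1, Ioo_mem_nhdsGT zero_lt_one] with ε hε hε1 hp
    obtain ⟨y, hy, hd⟩ := mem_packing.1 hp
    refine hε y ⟨?_, hy⟩ hd
    rw [mem_closedBall_iff_norm]
    have h2 := norm_sub_le_of_mem_dodecagon hd
    have h3 := norm_vertexVector_lt n k
    have h4 := norm_sub_le (ε * vertexVector n k) (w + ε * vertexVector n k - y)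
    rw [show (ε : ℂ) * vertexVector n k - (w + ε * vertexVector n k - y) = y - w by ring, norm_mul,
      Complex.norm_real, Real.norm_of_nonneg hε1.1.le] at h4
    have h5 := ratio_pow_le_one n
    have h6 := ratio_pow_le_one m
    have h7 := mul_le_mul hε1.2.le h3.le (norm_nonneg _) zero_le_one
    linarith

theorem mem_cells_iff_of_not_mem_packing {m n : ℕ} (hmn : m ≤ n) {z : ℂ}
    (h : ∀ l, m < l → l ≤ n → z ∉ packing l) : z ∈ cells n ↔ z ∈ cells m := by
  induction n, hmn using Nat.le_induction with
  | base => rfl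
  | succ n hmn ih =>
    rw [mem_cells_succ_iff (h _ (by omega) le_rfl)]
    exact ih fun l h1 h2 => h l h1 (by omega)

/-- If piece `j` looks into a piece of generation `n`, the translate making that piece red works.
Otherwise it looks into an earlier dodecagon, which is why strong induction is needed. -/
theorem exists_red (n : ℕ) : ∀ {x : ℂ} (j : Fin 12), x ∈ centres n →
    ∃ g ∈ hexagonalLattice, Red n (x - g) j := by
  induction n using Nat.strong_induction_on with
  | _ n ih =>
  intro w j hw
  cases n with
  | zero => exact ⟨w, hw, sub_self w⟩
  | succ n =>
    obtain ⟨x, hx, k, rfl⟩ := hw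
    have same : ∀ (y : ℂ) (l : Fin 12), y ∈ centres n → (Even (j : ℕ) ↔ Even (l : ℕ)) →
        ∃ g ∈ hexagonalLattice, Red (n + 1) (y + vertexVector n l - g) j := by
      intro y l hy hl
      obtain ⟨g, hg, hr⟩ := ih n (Nat.lt_succ_self n) l hy
      refine ⟨g, hg, ?_⟩
      rw [show y + vertexVector n l - g = y - g + vertexVector n l by ring,
        red_succ_iff (centres_sub hy hg), linkDir, if_pos hl, ← vertexVector_add_six,
        germ_iff_red (centres_sub hy hg) (by simp)]
      exact hr
    by_cases hj : Even (j : ℕ) ↔ Even (k : ℕ)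
    · exact same x k hx hj
    · rcases exists_link_or_subset n k hx with ⟨x', hx', k', hk', he⟩ | ⟨m, hm, y, hy, hsub⟩
      · rw [he]
        refine same x' k' hx' ?_
        clear * - hj hk'
        revert hk' hj; decide +revert
      · classical
        set w := x + vertexVector n k with hwdef
        let P : ℕ → Prop := fun l => ∃ y ∈ centres l, ∃ i,
          ∀ᶠ ε : ℝ in nhdsWithin 0 (Set.Ioi 0), w + ε * vertexVector n k ∈ openPiece l y i
        have hPm : P m := by
          rcases eventually_openPiece_or_not_packing n m w k with h | h
          · exact h
          · exfalso
            obtain ⟨ε, hε, hε0, hε1⟩ := (h.and (Ioo_mem_nhdsGT ratio_pos)).exists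
            refine hε (mem_packing.2 ⟨y, hy, hsub ?_⟩)
            rw [mem_closedBall_iff_norm, add_sub_cancel_left, norm_mul, Complex.norm_real,
              Real.norm_of_nonneg hε0.le, pow_succ]
            have h3 := norm_vertexVector_lt n k
            have h4 := mul_le_mul hε1.le h3.le (norm_nonneg _) ratio_pos.le
            nlinarith [mul_pos (ratio_pow_pos n) ratio_pos]
        -- Take the last packing that the germ enters. Later ones up to generation `n` are avoided
        -- near `w`, so the colour of that piece survives in `cells n`.
        obtain ⟨y, hy, i, hi⟩ := Nat.findGreatest_spec hm hPm
        have hle := Nat.findGreatest_le (P := P) n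
        have hgr : ∀ l, Nat.findGreatest P n < l → l ≤ n → ¬ P l := fun l h1 h2 =>
          Nat.findGreatest_is_greatest h1 h2
        generalize Nat.findGreatest P n = M at *
        obtain ⟨g, hg, hr⟩ := ih M (by omega) i hy
        refine ⟨g, hg, ?_⟩
        rw [show w - g = x - g + vertexVector n k by rw [hwdef]; ring,
          red_succ_iff (centres_sub hx hg), linkDir, if_neg hj]
        have hopen : IsOpen (openPiece M (y - g) i ∩ ⋂ l ∈ Set.Ioc M n, (packing l)ᶜ) :=
          (isOpen_openPiece _ _ _).inter
            ((Set.finite_Ioc M n).isOpen_biInter fun l _ => (isClosed_packing l).isOpen_compl)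
        have hsub2 : (openPiece M (y - g) i ∩ ⋂ l ∈ Set.Ioc M n, (packing l)ᶜ) ⊆
            interior (cells n) := by
          refine interior_maximal ?_ hopen
          rintro z ⟨h1, h2⟩
          simp only [Set.mem_iInter] at h2
          refine (mem_cells_iff_of_not_mem_packing hle fun l h3 h4 => h2 l ⟨h3, h4⟩).2 ?_
          exact piece_subset_cells (centres_sub hy hg) hr (openPiece_subset_piece _ _ _ h1)
        have hout : ∀ᶠ ε : ℝ in nhdsWithin 0 (Set.Ioi 0), ∀ l ∈ Set.Ioc M n,
            w + ε * vertexVector n k ∉ packing l := by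
          rw [Filter.eventually_all_finite (Set.finite_Ioc M n)]
          intro l hl
          rcases eventually_openPiece_or_not_packing n l w k with h | h
          · exact absurd h (hgr l hl.1 hl.2)
          · exact h
        filter_upwards [hi, hout] with ε h1 h2
        have e : x - g + vertexVector n k + ε * vertexVector n k =
            w + ε * vertexVector n k - g := by rw [hwdef]; ring
        rw [e]
        refine hsub2 ⟨(openPiece_sub g).2 h1, ?_⟩
        simp only [Set.mem_iInter]
        intro l hl
        exact fun hp => h2 l hl ((packing_sub hg).1 hp)

/-! ### The packings are dense -/

theorem comp_add_two (j : Fin 12) (z : ℂ) :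
    comp (j + 2) z = 1 / 2 * comp j z + Real.sqrt 3 / 2 * comp (j + 3) z := by
  have h := comp_add_one (j + 1) z
  rw [show j + 1 + 1 = j + 2 by clear * -; decide +revert,
    show j + 1 + 3 = j + 4 by clear * -; decide +revert, comp_add_one, comp_add_four] at h
  rw [h]
  linear_combination (1 / 4 * comp j z) * sqrt_three_sq

theorem comp_sub_one (j : Fin 12) (z : ℂ) :
    comp (j - 1) z = Real.sqrt 3 / 2 * comp j z - 1 / 2 * comp (j + 3) z := by
  have h := comp_add_two (j + 3) z
  have h6 := comp_add_six j z
  have h7 := comp_add_six (j - 1) z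
  rw [show j + 3 + 2 = j - 1 + 6 by clear * -; decide +revert,
    show j + 3 + 3 = j + 6 by clear * -; decide +revert, h6, h7] at h
  linarith

theorem comp_sub_three (j : Fin 12) (z : ℂ) : comp (j - 3) z = - comp (j + 3) z := by
  rw [← comp_add_six]; congr 1; clear * -; decide +revert

/-- The kite with apex `x` whose axis has direction `j * π / 6`. -/
def Kite (n : ℕ) (x : ℂ) (j : Fin 12) (z : ℂ) : Prop :=
  0 ≤ comp (j + 2) (z - x) ∧ comp (j + 4) (z - x) ≤ 0 ∧ comp (j + 1) (z - x) ≤ ratio ^ n / 2 ∧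
    comp (j - 1) (z - x) ≤ ratio ^ n / 2

theorem comp_self_vert (j : Fin 12) : comp j (vert j) = 1 / 2 := by
  rw [comp_vert, comp_zero_vert_cases, sub_self]; simp

theorem comp_self_vert_pred (j : Fin 12) : comp j (vert (j - 1)) = 1 / 2 := by
  rw [comp_vert, comp_zero_vert_cases, show j - 1 - j = 11 by decide +revert]; simp

theorem comp_add_three_vert (j : Fin 12) : comp (j + 3) (vert j) = ratio / 2 := by
  rw [comp_vert, comp_zero_vert_cases, show j - (j + 3) = 9 by decide +revert]; simp

theorem comp_add_three_vert_pred (j : Fin 12) : comp (j + 3) (vert (j - 1)) = - ratio / 2 := by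
  rw [comp_vert, comp_zero_vert_cases, show j - 1 - (j + 3) = 8 by decide +revert]
  simp

/-- What remains of the kite beyond edge `j` is an isosceles triangle over that edge. Its axis cuts
it into halves, each lying in a smaller kite whose apex is an end of the edge. -/
theorem Kite.step {n : ℕ} {x z : ℂ} {j : Fin 12} (h : Kite n x j z) (hz : z ∉ dodecagon n x) :
    ∃ k j', Kite (n + 1) (x + vertexVector n k) j' z := by
  have hr := ratio_pow_pos n
  have hs3 := sqrt_three_sq
  have hs1 := sqrt_three_gt
  obtain ⟨h1, h2, h3, h4⟩ := h
  have e : ∀ (i k : Fin 12), comp i (z - (x + vertexVector n k)) =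
      comp i (z - x) - ratio ^ n * comp i (vert k) := by
    intro i k
    rw [vertexVector_eq, ← comp_smul, ← comp_sub]; congr 1; ring
  have ht : ratio ^ (n + 1) = ratio ^ n * (2 - Real.sqrt 3) := by rw [pow_succ]; rfl
  have ha : ratio ^ n / 2 < comp j (z - x) := by
    by_contra! hle
    rcases le_total 0 (comp (j + 3) (z - x)) with hb | hb
    · exact hz (mem_dodecagon_of_comp hb h2 hle h3)
    · refine hz (mem_dodecagon_of_comp (k := j - 1) ?_ ?_ h4 ?_)
      · rwa [show j - 1 + 3 = j + 2 by clear * -; decide +revert]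
      · rwa [show j - 1 + 4 = j + 3 by clear * -; decide +revert]
      · rwa [sub_add_cancel]
  have hu2 := comp_add_two j (z - x)
  have hu4 := comp_add_four j (z - x)
  have hu1 := comp_add_one j (z - x)
  have hum := comp_sub_one j (z - x)
  rcases le_total 0 (comp (j + 3) (z - x)) with hb | hb
  · have f0 := comp_self_vert j
    have f3 := comp_add_three_vert j
    have f2 := comp_add_two j (vert j)
    have fm := comp_sub_one j (vert j)
    have fm3 := comp_sub_three j (vert j)
    have um3 := comp_sub_three j (z - x)
    rw [f0, f3, ratio] at f2 fm
    rw [f3, ratio] at fm3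
    refine ⟨j, j - 2, ?_, ?_, ?_, ?_⟩
    · rw [sub_add_cancel, e, f0]; linarith
    · rw [show j - 2 + 4 = j + 2 by clear * -; decide +revert, e, f2, hu2]
      rw [hu1] at h3
      nlinarith
    · rw [show j - 2 + 1 = j - 1 by clear * -; decide +revert, e, fm, ht]
      nlinarith
    · rw [show j - 2 - 1 = j - 3 by clear * -; decide +revert, e, fm3, um3, ht]
      nlinarith
  · have f0 := comp_self_vert_pred j
    have f3 := comp_add_three_vert_pred j
    have f4 := comp_add_four j (vert (j - 1))
    have f1 := comp_add_one j (vert (j - 1))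
    have f6 := comp_add_six j (vert (j - 1))
    have u6 := comp_add_six j (z - x)
    rw [f0, f3, ratio] at f4 f1
    refine ⟨j - 1, j + 2, ?_, ?_, ?_, ?_⟩
    · rw [show j + 2 + 2 = j + 4 by clear * -; decide +revert, e, f4, hu4]
      rw [hum] at h4
      nlinarith
    · rw [show j + 2 + 4 = j + 6 by clear * -; decide +revert, e, f6, u6, f0]; linarith
    · rw [show j + 2 + 1 = j + 3 by clear * -; decide +revert, e, f3, ht, ratio]
      nlinarith
    · rw [show j + 2 - 1 = j + 1 by clear * -; decide +revert, e, f1, ht]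
      nlinarith

theorem Kite.norm_le {n : ℕ} {x z : ℂ} {j : Fin 12} (h : Kite n x j z) :
    ‖z - x‖ ≤ ratio ^ n := by
  have hr := ratio_pow_pos n
  have hs1 := sqrt_three_gt
  have hs2 := sqrt_three_lt
  obtain ⟨h1, h2, h3, h4⟩ := h
  rw [comp_add_two] at h1
  rw [comp_add_four] at h2
  rw [comp_add_one] at h3
  rw [comp_sub_one] at h4
  refine le_of_sq_le_sq ?_ hr.le
  rw [norm_sq_eq_comp j]
  generalize comp j (z - x) = a at *
  generalize comp (j + 3) (z - x) = b at *
  have ha : 0 ≤ a := by linarith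
  have ha2 : a ≤ 0.6 * ratio ^ n := by nlinarith
  have hb1 : b ≤ 0.6 * ratio ^ n := by nlinarith
  have hb2 : -(0.6 * ratio ^ n) ≤ b := by nlinarith
  nlinarith

/-- With `x` a nearest lattice point, `z` lies in the hexagonal Voronoi cell of `x`, which six kites
with odd axes fill. -/
theorem exists_kite (z : ℂ) : ∃ x ∈ centres 0, ∃ j, Kite 0 x j z := by
  obtain ⟨x, hx, hmin⟩ := (isClosed_centres 0).exists_infDist_eq_dist ⟨0, zero_mem_centres⟩ z
  have hle : ∀ i : Fin 12, Even (i : ℕ) → comp i (z - x) ≤ 1 / 2 := by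
    intro i hi
    have h1 : dist z x ≤ dist z (x + om i) := by
      rw [← hmin]
      exact Metric.infDist_le_dist_of_mem
        (add_mem (S := AddSubgroup ℂ) hx (om_even_mem i hi) : x + om i ∈ hexagonalLattice)
    rw [dist_eq_norm, dist_eq_norm] at h1
    have h2 := pow_le_pow_left₀ (norm_nonneg _) h1 2
    have h3 : comp (i + 3) (om i) = 0 := by
      have h4 := norm_sq_eq_comp i (om i)
      rw [comp_om_self, norm_om] at h4
      nlinarith
    rw [norm_sq_eq_comp i, norm_sq_eq_comp i, show z - (x + om i) = z - x - om i by ring,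
      comp_sub i (z - x) (om i), comp_sub (i + 3) (z - x) (om i), comp_om_self, h3] at h2
    nlinarith
  have hs3 := sqrt_three_gt
  have hrec : ∀ i, comp (i + 2) (z - x) = Real.sqrt 3 * comp (i + 1) (z - x) - comp i (z - x) := by
    intro i
    rw [comp_add_two, comp_add_one]
    linear_combination (- 1 / 2 * comp i (z - x)) * sqrt_three_sq
  obtain ⟨k, h3, h4⟩ := exists_cone (z - x)
  refine ⟨x, hx, ?_⟩
  rcases Nat.even_or_odd (k : ℕ) with hk | hk
  · refine ⟨k + 1, ?_, ?_, ?_, ?_⟩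
    · rwa [show k + 1 + 2 = k + 3 by clear * -; decide +revert]
    · have := hrec (k + 3)
      rw [show k + 3 + 2 = k + 1 + 4 by clear * -; decide +revert,
        show k + 3 + 1 = k + 4 by clear * -; decide +revert] at this
      rw [this]
      nlinarith
    · have := hle (k + 1 + 1) (by clear * - hk; revert hk; decide +revert)
      simpa using this
    · have := hle (k + 1 - 1) (by simpa using hk)
      simpa using this
  · refine ⟨k, ?_, h4, ?_, ?_⟩
    · have := hrec (k + 2)
      rw [show k + 2 + 2 = k + 4 by clear * -; decide +revert,
        show k + 2 + 1 = k + 3 by clear * -; decide +revert] at this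
      nlinarith
    · have := hle (k + 1) (by clear * - hk; revert hk; decide +revert)
      simpa using this
    · have := hle (k - 1) (by clear * - hk; revert hk; decide +revert)
      simpa using this

/-- A point missed by all packings would lie in kites of every generation, whose apexes are centres
converging to it. -/
theorem exists_mem_packing {O : Set ℂ} (hO : IsOpen O) (hne : O.Nonempty) :
    ∃ m, (O ∩ packing m).Nonempty := by
  by_contra! hemp
  obtain ⟨z, hz⟩ := hne
  have hk : ∀ n, ∃ x ∈ centres n, ∃ j, Kite n x j z := by
    intro n
    induction n with
    | zero => exact exists_kite z
    | succ n ih =>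
      obtain ⟨x, hx, j, hj⟩ := ih
      have hzn : z ∉ dodecagon n x := fun h => by
        have : z ∈ O ∩ packing n := ⟨hz, mem_packing.2 ⟨x, hx, h⟩⟩
        rw [hemp n] at this
        exact this
      obtain ⟨k, j', hk⟩ := hj.step hzn
      exact ⟨_, ⟨x, hx, k, rfl⟩, j', hk⟩
  obtain ⟨δ, hδ, hb⟩ := Metric.isOpen_iff.1 hO z hz
  obtain ⟨n, hn⟩ := exists_pow_lt_of_lt_one hδ (show ratio < 1 by linarith [ratio_lt])
  obtain ⟨x, hx, j, hj⟩ := hk n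
  have : x ∈ O ∩ packing n := by
    refine ⟨hb ?_, mem_packing.2 ⟨x, hx, centre_mem_dodecagon _ _⟩⟩
    rw [mem_ball_iff_norm, norm_sub_rev]
    exact hj.norm_le.trans_lt hn
  rw [hemp n] at this
  exact this

/-- Later dodecagons meeting this one cluster within `3 / 4 * ratio ^ (m + 1)` of its vertices, and
`0.517 - 3 / 4 * 0.268 > 0.3`. -/
theorem not_mem_packing_of_near_centre {m n : ℕ} (hmn : m < n) {y z : ℂ} (hy : y ∈ centres m)
    (hz : z ∈ dodecagon m y) (hd : ‖z - y‖ < 0.3 * ratio ^ m) : z ∉ packing n := by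
  intro hp
  obtain ⟨x, hx, hzx⟩ := mem_packing.1 hp
  obtain ⟨k, hk⟩ := isDescendant_of_mem hmn hy hx hz hzx
  have h1 := hk.norm_sub_le_of_mem hzx
  have h2 : 0.517 * ratio ^ m < ‖vertexVector m k‖ := by
    rw [vertexVector_eq, norm_mul, Complex.norm_real, Real.norm_of_nonneg (ratio_pow_pos m).le,
      mul_comm]
    exact mul_lt_mul_of_pos_left (norm_vert_gt k) (ratio_pow_pos m)
  have h3 := norm_sub_le (z - y) (z - (y + vertexVector m k))
  rw [show z - y - (z - (y + vertexVector m k)) = vertexVector m k by ring] at h3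
  have h4 := mul_lt_mul_of_pos_right ratio_lt (ratio_pow_pos m)
  rw [pow_succ'] at h1
  linarith [ratio_pow_pos m]

/-! ### The limit -/

/-- The points with a neighbourhood contained in all but finitely many iterates. -/
def stable : Set ℂ := ⋃ n : ℕ, interior (⋂ m ≥ n, cells m)

theorem limitCell_colouring : limitCell colouring = closure stable := by
  simp only [limitCell, stable, iterate_colouring]

theorem isOpen_stable : IsOpen stable := isOpen_iUnion fun _ => isOpen_interior

theorem exists_mem_interior_of_mem_stable {z : ℂ} (hz : z ∈ stable) :
    ∃ n, ∀ m ≥ n, z ∈ interior (cells m) := by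
  obtain ⟨n, hn⟩ := Set.mem_iUnion.1 hz
  exact ⟨n, fun m hm => interior_mono (Set.iInter₂_subset m hm) hn⟩

theorem eq_zero_of_mem_stable {z g : ℂ} (hg : g ∈ hexagonalLattice) (hz : z ∈ stable)
    (hz' : z - g ∈ stable) : g = 0 := by
  by_contra h0
  obtain ⟨n, hn⟩ := exists_mem_interior_of_mem_stable hz
  obtain ⟨m, hm⟩ := exists_mem_interior_of_mem_stable hz'
  exact not_mem_interior_cells_sub (max n m) hg h0 (hn _ (le_max_left _ _))
    (hm _ (le_max_right _ _))

/-- Once no later packing touches a red region, its membership in the cells no longer changes. -/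
theorem subset_stable {m : ℕ} {x : ℂ} {k : Fin 12} (hx : x ∈ centres m) (hr : Red m x k)
    {W : Set ℂ} (hW : IsOpen W) (hsub : W ⊆ openPiece m x k)
    (hav : ∀ z ∈ W, ∀ n, m < n → z ∉ packing n) : W ⊆ stable := by
  intro z hz
  refine Set.mem_iUnion.2 ⟨m, ?_⟩
  refine interior_maximal (fun u hu => ?_) hW hz
  simp only [Set.mem_iInter]
  intro n hn
  rw [mem_cells_iff_of_not_mem_packing hn fun l h1 _ => hav u hu l h1]
  exact piece_subset_cells hx hr (openPiece_subset_piece _ _ _ (hsub hu))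

theorem exists_sub_mem_stable_of_subset {m : ℕ} {y : ℂ} {k : Fin 12} (hy : y ∈ centres m)
    {W : Set ℂ} (hW : IsOpen W) (hsub : W ⊆ openPiece m y k)
    (hav : ∀ z ∈ W, ∀ n, m < n → z ∉ packing n) :
    ∃ g ∈ hexagonalLattice, ∀ z ∈ W, z - g ∈ stable := by
  obtain ⟨g, hg, hr⟩ := exists_red m k hy
  refine ⟨g, hg, fun z hz => ?_⟩
  refine subset_stable (W := (fun u => u + g) ⁻¹' W) (centres_sub hy hg) hr
    (hW.preimage (continuous_add_const g)) ?_ ?_ (by simpa using hz)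
  · intro u hu
    have := (openPiece_sub g).2 (hsub hu)
    simpa using this
  · intro u hu n hn hp
    refine hav _ hu n hn ?_
    have := (packing_sub (n := n) (z := u + g) hg).1
    simp only [add_sub_cancel_right] at this
    exact this hp

theorem exists_sub_mem_stable {O : Set ℂ} (hO : IsOpen O) (hne : O.Nonempty) :
    ∃ z ∈ O, ∃ g ∈ hexagonalLattice, z - g ∈ stable := by
  obtain ⟨z, hz⟩ := hne
  obtain ⟨δ, hδ, hb⟩ := Metric.isOpen_iff.1 hO z hz
  have hB : IsOpen (Metric.ball z (δ / 2)) := Metric.isOpen_ball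
  have hBO : Metric.ball z (δ / 2) ⊆ O :=
    (Metric.ball_subset_ball (by linarith)).trans hb
  obtain ⟨m₀, hm₀⟩ := exists_mem_packing hB ⟨z, Metric.mem_ball_self (by positivity)⟩
  by_cases h : ∃ N, ∀ n ≥ N, ¬ (Metric.ball z (δ / 2) ∩ packing n).Nonempty
  -- Only finitely many packings meet the ball: inside the last of them nothing is repainted.
  · classical
    obtain ⟨N, hN⟩ := h
    have hle : m₀ ≤ N := by
      by_contra! hlt
      exact hN m₀ hlt.le hm₀
    have hspec := Nat.findGreatest_spec
      (P := fun n => (Metric.ball z (δ / 2) ∩ packing n).Nonempty) hle hm₀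
    have hgr : ∀ n, Nat.findGreatest (fun n => (Metric.ball z (δ / 2) ∩ packing n).Nonempty) N < n →
        ¬ (Metric.ball z (δ / 2) ∩ packing n).Nonempty := by
      intro n hn
      rcases le_total n N with h | h
      · exact Nat.findGreatest_is_greatest hn h
      · exact hN n h
    generalize Nat.findGreatest (fun n => (Metric.ball z (δ / 2) ∩ packing n).Nonempty) N = m at *
    obtain ⟨p, hp1, hp2⟩ := hspec
    obtain ⟨y, hy, k, u, hu1, hu2⟩ := exists_openPiece_of_isOpen hB hp1 hp2
    obtain ⟨g, hg, hW⟩ := exists_sub_mem_stable_of_subset hy (hB.inter (isOpen_openPiece m y k))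
      Set.inter_subset_right (fun v hv n hn hvn => hgr n hn ⟨v, hv.1, hvn⟩)
    exact ⟨u, hBO hu1, g, hg, hW u ⟨hu1, hu2⟩⟩
  -- Arbitrarily small dodecagons meet the ball: use the undisturbed central part of one that fits
  -- into the larger ball.
  · push Not at h
    obtain ⟨N, hN⟩ := exists_pow_lt_of_lt_one (show 0 < δ / 2 by positivity)
      (show ratio < 1 by linarith [ratio_lt])
    obtain ⟨m, hm, p, hp1, hp2⟩ := h N
    obtain ⟨y, hy, hpy⟩ := mem_packing.1 hp2
    have hr := ratio_pow_pos m
    have hrm : ratio ^ m < δ / 2 := (pow_le_pow_of_le_one ratio_pos.le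
      (by linarith [ratio_lt]) hm).trans_lt hN
    have hW : IsOpen (openPiece m y 0 ∩ Metric.ball y (0.3 * ratio ^ m)) :=
      (isOpen_openPiece _ _ _).inter Metric.isOpen_ball
    obtain ⟨g, hg, hgW⟩ := exists_sub_mem_stable_of_subset hy hW Set.inter_subset_left
      (fun v hv n hn => not_mem_packing_of_near_centre hn hy (openPiece_subset_dodecagon _ _ _ hv.1)
        (mem_ball_iff_norm.1 hv.2))
    have hu := add_smul_vert_mem_openPiece m y 0 (ε := 0.3 * ratio ^ m) (by positivity)
      (by linarith)
    have hun : ‖y + ((0.3 * ratio ^ m : ℝ) : ℂ) * vert 0 - y‖ < 0.3 * ratio ^ m := by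
      rw [add_sub_cancel_left, norm_mul, Complex.norm_real, Real.norm_of_nonneg (by positivity)]
      have := norm_vert_lt 0
      nlinarith
    refine ⟨_, hb ?_, g, hg, hgW _ ⟨hu, mem_ball_iff_norm.2 hun⟩⟩
    set u := y + ((0.3 * ratio ^ m : ℝ) : ℂ) * vert 0
    rw [mem_ball_iff_norm] at hp1 ⊢
    have h1 := norm_sub_le_of_mem_dodecagon hpy
    have h2 := norm_add_le (u - y) (p - z - (p - y))
    have h3 := norm_sub_le (p - z) (p - y)
    rw [show u - y + (p - z - (p - y)) = u - z by ring] at h2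
    linarith

/-! ### Extent of the limit: supporting lines, extreme points and diameter -/

/-- Each step adds at most the inradius of its generation; the bound is the partial sum of this
geometric series, with total `1 / (2 (1 - ratio)) = (√3 + 1) / 4`. -/
theorem IsDescendant.comp_le {n : ℕ} {x : ℂ} (h : IsDescendant 0 0 n x) (j : Fin 12) :
    comp j x ≤ (Real.sqrt 3 + 1) / 4 * (1 - ratio ^ n) := by
  have hs := sqrt_three_sq
  induction h with
  | refl => simp [comp_zero]
  | @step n x _ k ih =>
    have h1 := vertexVector_comp_le n j k
    have h2 : (Real.sqrt 3 + 1) / 4 * (1 - ratio) = 1 / 2 := by unfold ratio; nlinarith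
    have h3 : (Real.sqrt 3 + 1) / 4 * (1 - ratio ^ (n + 1)) =
        (Real.sqrt 3 + 1) / 4 * (1 - ratio ^ n) + ratio ^ n * (1 / 2) := by
      rw [← h2]; ring
    rw [comp_add, h3]
    linarith

theorem comp_le_of_mem_cells {n : ℕ} {z : ℂ} (hz : z ∈ cells n) (j : Fin 12) :
    comp j z ≤ (Real.sqrt 3 + 1) / 4 := by
  have := cells_subset n hz
  simp only [Set.mem_iUnion, exists_prop] at this
  obtain ⟨m, -, y, hy, h⟩ := this
  have h1 := IsDescendant.comp_le hy j
  have h2 := comp_le_of_mem_dodecagon h j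
  rw [comp_sub] at h2
  nlinarith [ratio_pow_pos m, sqrt_three_gt]

theorem comp_le_of_mem_closure_stable {z : ℂ} (hz : z ∈ closure stable) (j : Fin 12) :
    comp j z ≤ (Real.sqrt 3 + 1) / 4 := by
  refine closure_minimal (t := {z | comp j z ≤ (Real.sqrt 3 + 1) / 4}) ?_
    (isClosed_le (continuous_comp j) continuous_const) hz
  intro u hu
  obtain ⟨n, hn⟩ := exists_mem_interior_of_mem_stable hu
  exact comp_le_of_mem_cells (interior_subset (hn n le_rfl)) j

/-- The points of the limit at maximal distance from the origin. -/
def extreme (k : Fin 12) : ℂ := ((Real.sqrt 3 + 1) / 2 : ℝ) * vert k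

theorem eq_of_comp_eq {u v : ℂ} {j : Fin 12} (h : comp j u = comp j v)
    (h' : comp (j + 3) u = comp (j + 3) v) : u = v := by
  rw [comp_eq_of_zero_three j u, comp_eq_of_zero_three j v, h, h']

/-- Measured along the nearer edge normal, `a` is at most the inradius and `b` at most the half edge
`(√3 - 1) / 4 = ratio * (√3 + 1) / 4`. Equality forces both, hence a vertex. -/
theorem norm_sq_le_of_comp_le {u : ℂ} (h : ∀ j, comp j u ≤ (Real.sqrt 3 + 1) / 4) :
    ‖u‖ ^ 2 ≤ 1 / 2 ∧ (‖u‖ ^ 2 = 1 / 2 → ∃ k, u = extreme k) := by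
  have hs := sqrt_three_sq
  have hs1 := sqrt_three_gt
  have hs2 := sqrt_three_lt
  have key : ∀ a b : ℝ, 0 ≤ a → a ≤ (Real.sqrt 3 + 1) / 4 → 0 ≤ b → b ≤ (Real.sqrt 3 - 1) / 4 →
      a ^ 2 + b ^ 2 ≤ 1 / 2 ∧ (a ^ 2 + b ^ 2 = 1 / 2 →
        a = (Real.sqrt 3 + 1) / 4 ∧ b = (Real.sqrt 3 - 1) / 4) := by
    intro a b ha ha' hb hb'
    have h1 : a ^ 2 ≤ ((Real.sqrt 3 + 1) / 4) ^ 2 := pow_le_pow_left₀ ha ha' 2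
    have h2 : b ^ 2 ≤ ((Real.sqrt 3 - 1) / 4) ^ 2 := pow_le_pow_left₀ hb hb' 2
    have h3 : ((Real.sqrt 3 + 1) / 4) ^ 2 + ((Real.sqrt 3 - 1) / 4) ^ 2 = 1 / 2 := by nlinarith
    refine ⟨by linarith, fun he => ⟨?_, ?_⟩⟩
    · refine le_antisymm ha' (le_of_sq_le_sq (by linarith) ha)
    · refine le_antisymm hb' (le_of_sq_le_sq (by linarith) hb)
  obtain ⟨k, h3, h4⟩ := exists_cone u
  have e4 := comp_add_four k u
  have e1 := comp_add_one k u
  rcases le_total (comp (k + 3) u) (- comp (k + 4) u) with hle | hle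
  · have hk := h k
    rw [norm_sq_eq_comp k]
    obtain ⟨h5, h6⟩ := key (comp k u) (comp (k + 3) u) (by nlinarith) hk h3 (by nlinarith)
    refine ⟨h5, fun he => ⟨k, eq_of_comp_eq (j := k) ?_ ?_⟩⟩
    · rw [extreme, comp_smul, comp_self_vert, (h6 he).1]; ring
    · rw [extreme, comp_smul, comp_add_three_vert, (h6 he).2, ratio]; nlinarith
  · have hk := h (k + 1)
    have e14 : k + 1 + 3 = k + 4 := by clear * -; decide +revert
    rw [norm_sq_eq_comp (k + 1), e14]
    have e0 : comp k u = Real.sqrt 3 / 2 * comp (k + 1) u - 1 / 2 * comp (k + 4) u := by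
      have := comp_sub_one (k + 1) u
      rwa [add_sub_cancel_right, e14] at this
    have e3 : comp (k + 3) u = 1 / 2 * comp (k + 1) u + Real.sqrt 3 / 2 * comp (k + 4) u := by
      have := comp_add_two (k + 1) u
      rwa [show k + 1 + 2 = k + 3 by clear * -; decide +revert, e14] at this
    obtain ⟨h5, h6⟩ := key (comp (k + 1) u) (- comp (k + 4) u) (by nlinarith) hk (by linarith)
      (by nlinarith)
    rw [neg_sq] at h5 h6
    refine ⟨h5, fun he => ⟨k, eq_of_comp_eq (j := k + 1) ?_ ?_⟩⟩
    · have := comp_self_vert_pred (k + 1)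
      rw [add_sub_cancel_right] at this
      rw [extreme, comp_smul, this, (h6 he).1]; ring
    · have := comp_add_three_vert_pred (k + 1)
      rw [add_sub_cancel_right] at this
      rw [extreme, comp_smul, this, e14, ratio]
      have := (h6 he).2
      nlinarith

theorem norm_sq_le_of_mem {z : ℂ} (hz : z ∈ closure stable) : ‖z‖ ^ 2 ≤ 1 / 2 :=
  (norm_sq_le_of_comp_le (comp_le_of_mem_closure_stable hz)).1

theorem norm_sq_extreme (k : Fin 12) : ‖extreme k‖ ^ 2 = 1 / 2 := by
  have hs := sqrt_three_sq
  rw [extreme, norm_mul, mul_pow, norm_sq_vert, Complex.norm_real, Real.norm_eq_abs, sq_abs, ratio]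
  linear_combination (-Real.sqrt 3 / 4) * hs

/-- Always moving to vertex `k` keeps piece `k` red, since inward germs copy its colour. The centres
`x n` are thus limits of stable points, and they converge to the extreme point. -/
theorem extreme_mem (k : Fin 12) : extreme k ∈ closure stable := by
  have hs := sqrt_three_sq
  have hone : ratio < 1 := by linarith [ratio_lt]
  set x : ℕ → ℂ := fun n => ((∑ i ∈ Finset.range n, ratio ^ i : ℝ) : ℂ) * vert k with hx
  have hsucc : ∀ n, x (n + 1) = x n + vertexVector n k := by
    intro n
    simp only [hx]
    rw [Finset.sum_range_succ, vertexVector_eq]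
    push_cast; ring
  have hmem : ∀ n, x n ∈ centres n ∧ Red n (x n) k := by
    intro n
    induction n with
    | zero =>
      have h0 : x 0 = 0 := by simp [hx]
      rw [h0]
      exact ⟨zero_mem_centres, rfl⟩
    | succ n ih =>
      rw [hsucc]
      refine ⟨⟨_, ih.1, k, rfl⟩, ?_⟩
      rw [red_succ_iff ih.1, linkDir, if_pos Iff.rfl, ← vertexVector_add_six,
        germ_iff_red ih.1 (by simp)]
      exact ih.2
  have hcl : ∀ n, x n ∈ closure stable := by
    intro n
    have hr := ratio_pow_pos n
    have hW := subset_stable (hmem n).1 (hmem n).2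
      ((isOpen_openPiece n (x n) k).inter
        (Metric.isOpen_ball : IsOpen (Metric.ball (x n) (0.3 * ratio ^ n))))
      Set.inter_subset_left
      (fun v hv m hm => not_mem_packing_of_near_centre hm (hmem n).1
        (openPiece_subset_dodecagon _ _ _ hv.1) (mem_ball_iff_norm.1 hv.2))
    refine closure_mono hW ?_
    have hp : x n ∈ piece n (x n) k := by
      rw [mem_piece_iff]
      simp only [sub_self, comp_zero]
      exact ⟨le_rfl, le_rfl, by positivity, by positivity⟩
    rw [mem_closure_iff]
    intro o ho hxo
    obtain ⟨u, ⟨h1, h2⟩, h3⟩ := mem_closure_iff.1 (piece_subset_closure_openPiece _ _ _ hp)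
      _ (ho.inter (Metric.isOpen_ball : IsOpen (Metric.ball (x n) (0.3 * ratio ^ n))))
      ⟨hxo, Metric.mem_ball_self (by positivity)⟩
    exact ⟨u, h1, h3, h2⟩
  have hlim : Filter.Tendsto x Filter.atTop (nhds (extreme k)) := by
    have h1 := (hasSum_geometric_of_lt_one ratio_pos.le hone).tendsto_sum_nat
    have h2 : (1 - ratio)⁻¹ = (Real.sqrt 3 + 1) / 2 := by
      rw [inv_eq_iff_eq_inv, eq_comm, inv_eq_iff_eq_inv, ← one_div, eq_div_iff (by linarith), ratio]
      linarith
    rw [h2] at h1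
    exact ((Complex.continuous_ofReal.tendsto _).comp h1).mul_const _
  exact isClosed_closure.mem_of_tendsto hlim (Filter.Eventually.of_forall hcl)

theorem norm_le_of_mem {z : ℂ} (hz : z ∈ closure stable) : ‖z‖ ≤ Real.sqrt 2 / 2 := by
  refine le_of_sq_le_sq ?_ (by positivity)
  rw [div_pow, Real.sq_sqrt (by norm_num)]
  linarith [norm_sq_le_of_mem hz]

theorem norm_extreme (k : Fin 12) : ‖extreme k‖ = Real.sqrt 2 / 2 := by
  refine le_antisymm (norm_le_of_mem (extreme_mem k)) (le_of_sq_le_sq ?_ (norm_nonneg _))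
  rw [div_pow, Real.sq_sqrt (by norm_num), norm_sq_extreme]
  norm_num

theorem extreme_six : extreme 6 = - extreme 0 := by
  have : vert 6 = - vert 0 := vert_add_six 0
  rw [extreme, extreme, this]; ring

theorem isCompact_closure_stable : IsCompact (closure stable) := by
  refine Metric.isCompact_of_isClosed_isBounded isClosed_closure
    ((Metric.isBounded_closedBall (x := (0 : ℂ)) (r := Real.sqrt 2 / 2)).subset fun z hz => ?_)
  rw [mem_closedBall_iff_norm, sub_zero]
  exact norm_le_of_mem hz

theorem diam_closure_stable : Metric.diam (closure stable) = Real.sqrt 2 := by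
  refine le_antisymm (Metric.diam_le_of_forall_dist_le (by positivity) fun x hx y hy => ?_) ?_
  · rw [dist_eq_norm]
    linarith [norm_sub_le x y, norm_le_of_mem hx, norm_le_of_mem hy]
  · have h := Metric.dist_le_diam_of_mem isCompact_closure_stable.isBounded (extreme_mem 0)
      (extreme_mem 6)
    rw [dist_eq_norm, extreme_six, show extreme 0 - -extreme 0 = (2 : ℝ) * extreme 0 by
      push_cast; ring, norm_mul, norm_extreme, Complex.norm_real] at h
    rw [Real.norm_of_nonneg (by norm_num)] at h
    linarith

/-! ### The limit is a fundamental cell -/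

theorem mem_vadd_iff {g x : ℂ} {D : Set ℂ} : x ∈ g +ᵥ D ↔ x - g ∈ D := by
  rw [Set.mem_vadd_set]
  constructor
  · rintro ⟨y, hy, rfl⟩
    simpa [vadd_eq_add] using hy
  · intro h
    exact ⟨x - g, h, by simp [vadd_eq_add]⟩

/-- The sum of the closed lattice and a compact set is closed, and it is dense by
`exists_sub_mem_stable`. -/
theorem exists_sub_mem_closure_stable (x : ℂ) :
    ∃ g ∈ hexagonalLattice, x - g ∈ closure stable := by
  have hcl : IsClosed ((hexagonalLattice : Set ℂ) + closure stable) :=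
    IsClosed.add_right_of_isCompact (isClosed_centres 0) isCompact_closure_stable
  have hx : x ∈ (hexagonalLattice : Set ℂ) + closure stable := by
    by_contra hx
    obtain ⟨z, hz, g, hg, h⟩ := exists_sub_mem_stable hcl.isOpen_compl ⟨x, hx⟩
    exact hz (Set.mem_add.2 ⟨g, hg, z - g, subset_closure h, by ring⟩)
  obtain ⟨g, hg, u, hu, rfl⟩ := Set.mem_add.1 hx
  exact ⟨g, hg, by simpa using hu⟩

theorem isFundamentalCell_closure_stable :
    IsFundamentalCell hexagonalLattice (closure stable) := by
  refine ⟨?_, ?_, ?_⟩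
  -- Representatives come from `stable` whenever the coset meets it. As it does so at most once, the
  -- transversal contains `stable` and has the same closure.
  · have hex : ∀ q : ℂ ⧸ hexagonalLattice, ∃ z ∈ closure stable,
        (z : ℂ ⧸ hexagonalLattice) = q ∧
          ((∃ u ∈ stable, (u : ℂ ⧸ hexagonalLattice) = q) → z ∈ stable) := by
      intro q
      by_cases h : ∃ u ∈ stable, (u : ℂ ⧸ hexagonalLattice) = q
      · obtain ⟨u, hu, hq⟩ := h
        exact ⟨u, subset_closure hu, hq, fun _ => hu⟩
      · obtain ⟨x, rfl⟩ := QuotientAddGroup.mk_surjective q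
        obtain ⟨g, hg, hx⟩ := exists_sub_mem_closure_stable x
        refine ⟨x - g, hx, ?_, fun h' => absurd h' h⟩
        rw [QuotientAddGroup.eq]
        simpa using hg
    choose σ hσ hq hst using hex
    have hU : stable ⊆ Set.range σ := by
      intro u hu
      have h1 := hst (u : ℂ ⧸ hexagonalLattice) ⟨u, hu, rfl⟩
      have h2 := QuotientAddGroup.eq.1 (hq (u : ℂ ⧸ hexagonalLattice))
      have h3 := eq_zero_of_mem_stable h2 hu (by simpa using h1)
      refine ⟨u, ?_⟩
      linear_combination -h3
    refine ⟨Set.range σ, fun x => ?_, ?_⟩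
    · have hg := QuotientAddGroup.eq.1 (hq (x : ℂ ⧸ hexagonalLattice))
      refine ⟨x - σ x, ⟨?_, ?_⟩, ?_⟩
      · rwa [sub_eq_neg_add]
      · rw [mem_vadd_iff, sub_sub_cancel]
        exact ⟨_, rfl⟩
      · rintro g ⟨hg', hgx⟩
        rw [mem_vadd_iff] at hgx
        obtain ⟨q, hq'⟩ := hgx
        have h1 : q = (x : ℂ ⧸ hexagonalLattice) := by
          rw [← hq q, hq', QuotientAddGroup.eq]
          simpa using hg'
        rw [h1] at hq'
        rw [hq']; ring
    · refine Set.Subset.antisymm (closure_minimal ?_ isClosed_closure) (closure_mono hU)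
      rintro _ ⟨q, rfl⟩
      exact hσ q
  · refine Set.eq_univ_of_forall fun x => ?_
    obtain ⟨g, hg, h⟩ := exists_sub_mem_closure_stable x
    exact Set.mem_iUnion₂.2 ⟨g, hg, mem_vadd_iff.2 h⟩
  · intro g hg h hh hne
    rw [Set.disjoint_left]
    intro z hz hz'
    have hV : IsOpen (interior (g +ᵥ closure stable) ∩ interior (h +ᵥ closure stable)) :=
      isOpen_interior.inter isOpen_interior
    -- Two approximations turn an overlap of interiors into one point lying in both translates of
    -- the open set `stable`.
    obtain ⟨u, hu1, hu2⟩ := mem_closure_iff.1 (mem_vadd_iff.1 (interior_subset hz))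
      _ (hV.preimage (continuous_add_const g)) (by simpa using ⟨hz, hz'⟩)
    have hu3 := mem_vadd_iff.1 (interior_subset hu1.2)
    obtain ⟨v, hv1, hv2⟩ := mem_closure_iff.1 hu3 _
      (isOpen_stable.preimage (continuous_sub_right (g - h)))
      (by
        rw [Set.mem_preimage]
        convert hu2 using 1
        ring)
    exact hne (sub_eq_zero.1 (eq_zero_of_mem_stable (sub_mem hg hh) hv2 hv1))

/-! ### The symmetry group of the limit -/

theorem mapsTo_stable {φ : ℂ ≃ₗᵢ[ℝ] ℂ} {σ : Equiv.Perm (Fin 12)} (h : IsPackingSymmetry φ σ)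
    (h' : IsPackingSymmetry φ.symm σ.symm) : Set.MapsTo φ stable stable := by
  intro z hz
  obtain ⟨n, hn⟩ := Set.mem_iUnion.1 hz
  refine Set.mem_iUnion.2 ⟨n, ?_⟩
  have himg : φ '' interior (⋂ m ≥ n, cells m) ⊆ interior (⋂ m ≥ n, cells m) := by
    refine interior_maximal ?_ (φ.toHomeomorph.isOpenMap _ isOpen_interior)
    rintro _ ⟨u, hu, rfl⟩
    have hu' := interior_subset hu
    simp only [Set.mem_iInter] at hu' ⊢
    exact fun m hm => cells_invariant h h' m (hu' m hm)
  exact himg ⟨z, hn, rfl⟩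

theorem mem_symmetryGroup {φ : ℂ ≃ₗᵢ[ℝ] ℂ} {σ : Equiv.Perm (Fin 12)} (h : IsPackingSymmetry φ σ)
    (h' : IsPackingSymmetry φ.symm σ.symm) :
    φ.toIsometryEquiv ∈ symmetryGroup (closure stable) := by
  change φ '' closure stable = closure stable
  refine Set.Subset.antisymm ?_ fun z hz => ⟨φ.symm z, ?_, φ.apply_symm_apply z⟩
  · rintro _ ⟨z, hz, rfl⟩
    exact map_mem_closure φ.continuous hz (mapsTo_stable h h')
  · exact map_mem_closure φ.symm.continuous hz (mapsTo_stable h' (by simpa using h))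

theorem coe_circle_exp : ((Circle.exp (2 * Real.pi / (12 : ℕ)) : Circle) : ℂ) = om 1 := by
  rw [Circle.coe_exp, om, unitVector]
  congr 1
  push_cast
  simp only [Fin.val_one]
  push_cast
  ring

theorem isPackingSymmetry_of_apply {φ : ℂ ≃ₗᵢ[ℝ] ℂ} {i : Fin 12} (hi : Odd (i : ℕ))
    (h : ∀ z, φ z = om i * z) : IsPackingSymmetry φ (Equiv.addLeft i) where
  map_vert k := by
    rw [h, Equiv.coe_addLeft, vert_add]
  mem_piece {n x z k} hz := by
    rw [mem_piece_iff] at hz ⊢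
    rw [h, h, ← mul_sub]
    simp only [comp_om_mul, Equiv.coe_addLeft]
    rw [show i + k + 3 - i = k + 3 by clear * -; decide +revert,
      show i + k + 4 - i = k + 4 by clear * -; decide +revert, add_sub_cancel_left,
      show i + k + 1 - i = k + 1 by clear * -; decide +revert]
    exact hz
  even_iff k := by
    rw [Equiv.coe_addLeft]
    clear * - hi
    revert hi; decide +revert

/-- Negating the angle `(2k + 1)π / 12` gives index `-1 - k`, which has the other parity. -/
theorem isPackingSymmetry_conj :
    IsPackingSymmetry Complex.conjLIE (Equiv.subLeft (-1 : Fin 12)) := by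
  have hom : ∀ k, (starRingEnd ℂ) (om k) = om (-k) := by
    intro k
    have h1 : om k * (starRingEnd ℂ) (om k) = 1 := by
      rw [Complex.mul_conj, Complex.normSq_eq_norm_sq, norm_om]; simp
    have h2 := om_neg_mul k
    refine mul_left_cancel₀ (om_ne_zero k) ?_
    rw [h1, mul_comm, h2]
  have hcomp : ∀ (j : Fin 12) (z : ℂ), comp j ((starRingEnd ℂ) z) = comp (-j) z := by
    intro j z
    unfold comp
    rw [← hom, ← map_mul, Complex.conj_re, neg_neg]
  refine ⟨fun k => ?_, fun {n x z k} hz => ?_, fun k => ?_⟩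
  · rw [Complex.conjLIE_apply, vert_eq_toC]
    have hv : (starRingEnd ℂ) (vert 0) = vert (-1) := by
      rw [vert_eq_toC, vert_eq_toC]
      apply Complex.ext <;>
        simp [toC, vertexInt, mulZeta, show ((-1 : Fin 12) : ℕ) = 11 from rfl] <;> ring
    have hk : vert k = om k * vert 0 := by rw [← vert_add, add_zero]
    rw [← vert_eq_toC, hk, map_mul, hom, hv, ← vert_add, Equiv.subLeft_apply]
    congr 1
    clear * -; decide +revert
  · rw [mem_piece_iff] at hz ⊢
    rw [Complex.conjLIE_apply, Complex.conjLIE_apply, ← map_sub]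
    simp only [hcomp, Equiv.subLeft_apply]
    obtain ⟨h3, h4, h0, h1⟩ := hz
    have e1 := comp_add_six (k + 4) (z - x)
    have e2 := comp_add_six (k + 3) (z - x)
    refine ⟨?_, ?_, ?_, ?_⟩
    · rw [show -(-1 - k + 3) = k + 4 + 6 by clear * -; decide +revert, e1]; linarith
    · rw [show -(-1 - k + 4) = k + 3 + 6 by clear * -; decide +revert, e2]; linarith
    · rwa [show -(-1 - k) = k + 1 by clear * -; decide +revert]
    · rwa [show -(-1 - k + 1) = k by clear * -; decide +revert]
  · rw [Equiv.subLeft_apply]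
    clear * -; decide +revert

/-- The rotation through `π / 6`. -/
def turnIsometry : ℂ ≃ᵢ ℂ :=
  (rotation (Circle.exp (2 * Real.pi / (12 : ℕ)))).toIsometryEquiv

theorem turnIsometry_pow_apply (n : ℕ) (z : ℂ) : (turnIsometry ^ n) z = unitVector n * z := by
  induction n with
  | zero => rw [unitVector_eq_pow]; simp
  | succ n ih =>
    rw [pow_succ', IsometryEquiv.mul_apply, ih]
    change (Circle.exp (2 * Real.pi / (12 : ℕ)) : ℂ) * _ = _
    rw [coe_circle_exp, unitVector_eq_pow n, unitVector_eq_pow (n + 1), pow_succ]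
    change unitVector 1 * _ = _
    ring

theorem turnIsometry_mem : turnIsometry ∈ dihedralMotions 12 :=
  Subgroup.subset_closure (Or.inl rfl)

theorem conj_mem_dihedralMotions : Complex.conjLIE.toIsometryEquiv ∈ dihedralMotions 12 :=
  Subgroup.subset_closure (Or.inr rfl)

theorem parallelogram (p q : ℂ) : ‖p + q‖ ^ 2 + ‖p - q‖ ^ 2 = 2 * (‖p‖ ^ 2 + ‖q‖ ^ 2) := by
  have := parallelogram_law_with_norm ℝ p q
  nlinarith

theorem symmetryGroup_closure_stable :
    symmetryGroup (closure stable) = dihedralMotions 12 := by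
  refine le_antisymm ?_ ?_
  · intro f hf
    have hf : f '' closure stable = closure stable := hf
    have hmem : ∀ z ∈ closure stable, f z ∈ closure stable := fun z hz => by
      rw [← hf]; exact ⟨z, hz, rfl⟩
    have h2 : Real.sqrt 2 ^ 2 = 2 := Real.sq_sqrt (by norm_num)
    set p := f (extreme 0) with hp
    set q := f (extreme 6) with hq
    have hp1 := norm_sq_le_of_mem (hmem _ (extreme_mem 0))
    have hq1 := norm_sq_le_of_mem (hmem _ (extreme_mem 6))
    rw [← hp] at hp1
    rw [← hq] at hq1
    have hpq : ‖p - q‖ ^ 2 = 2 := by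
      rw [← dist_eq_norm, hp, hq, f.isometry.dist_eq, dist_eq_norm, extreme_six,
        show extreme 0 - -extreme 0 = (2 : ℝ) * extreme 0 by push_cast; ring, norm_mul, mul_pow,
        norm_sq_extreme, Complex.norm_real]
      norm_num
    -- Two points of the disc of radius `√2 / 2` at distance `√2` must be antipodal.
    have hpar := parallelogram p q
    have hsum : q = -p := by
      have : ‖p + q‖ ^ 2 = 0 := le_antisymm (by linarith) (sq_nonneg _)
      rw [sq_eq_zero_iff, norm_eq_zero] at this
      linear_combination this
    have hpn : ‖p‖ ^ 2 = 1 / 2 := by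
      rw [hsum, sub_neg_eq_add, add_neg_cancel, norm_zero, ← two_mul, norm_mul, mul_pow] at hpar
      rw [hsum, sub_neg_eq_add, ← two_mul, norm_mul, mul_pow] at hpq
      norm_num at hpq
      linarith
    -- `f 0` is at distance `√2 / 2` from both `p` and `-p`, so the parallelogram law makes it 0.
    have h0 : f 0 = 0 := by
      have e1 : ‖f 0 - p‖ ^ 2 = 1 / 2 := by
        rw [← dist_eq_norm, hp, f.isometry.dist_eq, dist_eq_norm, zero_sub, norm_neg,
          norm_sq_extreme]
      have e2 : ‖f 0 + p‖ ^ 2 = 1 / 2 := by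
        rw [← sub_neg_eq_add, ← hsum, ← dist_eq_norm, hq, f.isometry.dist_eq, dist_eq_norm,
          zero_sub, norm_neg, norm_sq_extreme]
      have e3 := parallelogram (f 0) p
      have : ‖f 0‖ ^ 2 = 0 := by linarith
      rwa [sq_eq_zero_iff, norm_eq_zero] at this
    obtain ⟨k, hk⟩ := (norm_sq_le_of_comp_le (comp_le_of_mem_closure_stable
      (hmem _ (extreme_mem 0)))).2 hpn
    have hsc : (((Real.sqrt 3 + 1) / 2 : ℝ) : ℂ) ≠ 0 := by
      have : (0 : ℝ) < (Real.sqrt 3 + 1) / 2 := by positivity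
      exact_mod_cast this.ne'
    have hv0 : ∀ i, vert i ≠ 0 := fun i h => by
      have := norm_sq_vert i
      rw [h, norm_zero] at this
      linarith [ratio_pos]
    have hpow : ∀ i : Fin 12, turnIsometry ^ (i : ℕ) ∈ dihedralMotions 12 := fun i =>
      pow_mem turnIsometry_mem _
    -- A linear isometry of the plane is a rotation, possibly after conjugation; the image of one
    -- extreme point determines its angle.
    obtain ⟨a, ha⟩ := linear_isometry_complex (f.toRealLinearIsometryEquivOfMapZero h0)
    have hfa : ∀ z, f z = f.toRealLinearIsometryEquivOfMapZero h0 z := fun z => rfl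
    rcases ha with ha | ha
    · have hfz : ∀ z, f z = a * z := fun z => by rw [hfa, ha, rotation_apply]
      have hak : (a : ℂ) = om k := by
        rw [hfz, extreme, extreme, mul_left_comm] at hk
        have h1 := mul_left_cancel₀ hsc hk
        rw [← add_zero k, vert_add] at h1
        exact mul_right_cancel₀ (hv0 0) h1
      have : f = turnIsometry ^ (k : ℕ) := by
        ext z
        rw [hfz, hak, turnIsometry_pow_apply]; rfl
      rw [this]
      exact hpow k
    · have hfz : ∀ z, f z = a * Complex.conjLIE z := fun z => by
        rw [hfa, ha, LinearIsometryEquiv.trans_apply, rotation_apply]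
      have hak : (a : ℂ) = om (k + 1) := by
        have h11 : Complex.conjLIE (extreme 0) = extreme (-1) := by
          have := isPackingSymmetry_conj.map_vert 0
          rw [extreme, extreme, ← Complex.real_smul, map_smul, this, Complex.real_smul]
          rfl
        rw [hfz, h11, extreme, extreme, mul_left_comm] at hk
        have h1 := mul_left_cancel₀ hsc hk
        rw [show k = k + 1 + (-1) by clear * -; decide +revert, vert_add] at h1
        exact mul_right_cancel₀ (hv0 (-1)) h1
      have : f = turnIsometry ^ ((k + 1 : Fin 12) : ℕ) * Complex.conjLIE.toIsometryEquiv := by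
        ext z
        rw [hfz, hak, IsometryEquiv.mul_apply, turnIsometry_pow_apply]; rfl
      rw [this]
      exact mul_mem (hpow _) conj_mem_dihedralMotions
  · refine (Subgroup.closure_le _).2 ?_
    rintro f (rfl | rfl)
    · refine mem_symmetryGroup (σ := Equiv.addLeft 1)
        (isPackingSymmetry_of_apply (by decide) fun z => ?_) ?_
      · rw [rotation_apply, coe_circle_exp]
      · have e : (Equiv.addLeft (1 : Fin 12)).symm = Equiv.addLeft (-1) := by
          ext k; simp
        rw [e]
        refine isPackingSymmetry_of_apply (by decide) fun z => ?_
        rw [LinearIsometryEquiv.symm_apply_eq, rotation_apply, coe_circle_exp, ← mul_assoc,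
          ← om_add, add_neg_cancel, om_zero, one_mul]
    · refine mem_symmetryGroup isPackingSymmetry_conj ?_
      have e : (Equiv.subLeft (-1 : Fin 12)).symm = Equiv.subLeft (-1) := by
        ext k; revert k; decide
      rw [e]
      exact isPackingSymmetry_conj

end HexagonalCell

end

theorem mainTheorem4 :
    ∃ c : ℕ → ℂ → HexagonalCell.Colour,
      HexagonalCell.IsRefinement c ∧
      IsCompact (HexagonalCell.limitCell c) ∧
      HexagonalCell.IsFundamentalCell HexagonalCell.hexagonalLattice
        (HexagonalCell.limitCell c) ∧
      HexagonalCell.symmetryGroup (HexagonalCell.limitCell c) =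
        HexagonalCell.dihedralMotions 12 ∧
      Metric.diam (HexagonalCell.limitCell c) = Real.sqrt 2 := by
  refine ⟨HexagonalCell.colouring, HexagonalCell.isRefinement_colouring, ?_⟩
  rw [HexagonalCell.limitCell_colouring]
  exact ⟨HexagonalCell.isCompact_closure_stable, HexagonalCell.isFundamentalCell_closure_stable,
    HexagonalCell.symmetryGroup_closure_stable, HexagonalCell.diam_closure_stable⟩
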